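/- Let $K$ be a commutative ring. A dg-category $\mathcal{C}$ is a $K$-linear category whose morphism modules are differential $\mathbb{Z}$-graded $K$-modules (with differential of degree $+1$), such that composition has degree zero and satisfies $d(g\circ f)=d(g)\circ f+(-1)^{|g|}g\circ d(f)$. Let $\mathrm{DgMod}(K)$ be the dg-category of dg $K$-modules, and for a small dg-category $\mathcal{A}$ let $\mathrm{DgMod}(\mathcal{A})$ be the dg-category of dg-functors $\mathcal{A}\to\mathrm{DgMod}(K)$, with $\mathrm{Hom}(M,N)=\bigoplus_{n}\mathrm{DgNat}^n(M,N)$, where $\mathrm{DgNat}^n(M,N)$ consists of the families $\eta_X\in \mathrm{Hom}^n(M(X),N(X))$ with $N(f)\circ\eta_X=(-1)^{n|f|}\eta_Y\circ M(f)$ for homogeneous $f:X\to Y$, and $d(\eta)_X=d(\eta_X)$. For a dg-functor $F:\mathcal{A}\to\mathcal{C}$ let $F_*:\mathrm{DgMod}(\mathcal{C})\to\mathrm{DgMod}(\mathcal{A})$, $S\mapsto S\circ F$. Let $\mathcal{C}$ be a small dg-category with finite coproducts and $\mathcal{B}\subseteq\mathcal{C}$ a full dg-subcategory closed under finite coproducts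 (a coproduct of finitely many objects of $\mathcal{B}$ is isomorphic to an object of $\mathcal{B}$). Let $\mathcal{I}_{\mathcal{B}}(X,Y)^n$ be the set of $f\in\mathcal{C}(X,Y)^n$ that can be written $f=h\circ g$ with $g:X\to B$, $h:B\to Y$ and $B\in\mathcal{B}$; then $\mathcal{I}_{\mathcal{B}}=\bigoplus_n\mathcal{I}_{\mathcal{B}}^n$ is a dg-ideal of $\mathcal{C}$. Let $\pi:\mathcal{C}\to\mathcal{C}/\mathcal{I}_{\mathcal{B}}$ be the projection, $j:\mathcal{B}\to\mathcal{C}$ the inclusion, $\pi_*:\mathrm{DgMod}(\mathcal{C}/\mathcal{I}_{\mathcal{B}})\to\mathrm{DgMod}(\mathcal{C})$ the restriction along $\pi$ and $j^*:\mathrm{DgMod}(\mathcal{C})\to\mathrm{DgMod}(\mathcal{B})$ the restriction along $j$. Then there exist dg-functors $$\pi^*=\mathrm{Lan}_\pi(-),\quad \pi^!=\mathrm{Ran}_\pi(-):\ \mathrm{DgMod}(\mathcal{C})\to\mathrm{DgMod}(\mathcal{C}/\mathcal{I}_{\mathcal{B}}),\qquad j_!=\mathrm{Lan}_j(-),\quad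 j_*=\mathrm{Ran}_j(-):\ \mathrm{DgMod}(\mathcal{B})\to\mathrm{DgMod}(\mathcal{C}),$$ given on objects by (pointwise, enriched) left and right dg Kan extensions, with closed degree-zero units, respectively counits, that are natural in the module, such that 1. $(\pi^*,\pi_*)$, $(\pi_*,\pi^!)$, $(j_!,j^*)$ and $(j^*,j_*)$ are dg-adjoint pairs, i.e. there are isomorphisms of dg $K$-modules $\mathrm{Hom}(L X,Y)\cong\mathrm{Hom}(X,R Y)$ natural in $X$ and $Y$; 2. $\mathrm{Im}(\pi_*)=\mathrm{Ker}(j^*)$, where $\mathrm{Im}$ denotes the essential image (with respect to arbitrary isomorphisms and, equally, with respect to closed isomorphisms of degree zero) and $\mathrm{Ker}(j^*)$ consists of the $M$ with $j^*(M)\cong 0$; 3. $\pi_*$, $j_!$ and $j_*$ are dg-fully faithful, i.e. they induce isomorphisms of dg $K$-modules on all morphism modules. That is, these six functors form a recollement $\mathrm{DgMod}(\mathcal{C}/\mathcal{I}_{\mathcal{B}})\to\mathrm{DgMod}(\mathcal{C})\to\mathrm{DgMod}(\mathcal{B})$. -/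

import Mathlib

open CategoryTheory CategoryTheory.Limits

universe w v v₁ v₂ v₃ u u₁ u₂ u₃

noncomputable section

namespace DG

/-! ### Differential graded modules -/

section Modules

variable {K : Type w} [CommRing K]

/-- The structure of a differential graded `K`-module on a `K`-module `V`: an internal direct sum
decomposition `V = ⨁ Vⁿ` indexed by `ℤ` and a differential of degree `+1` with square zero. -/
structure DGStructure (K : Type w) [CommRing K] (V : Type v) [AddCommGroup V] [Module K V] where
  /-- The homogeneous component of degree `n`. -/
  gr : ℤ → Submodule K V
  isInternal : DirectSum.IsInternal gr
  /-- The differential. -/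
  d : V →ₗ[K] V
  d_mem : ∀ {n : ℤ} {x : V}, x ∈ gr n → d x ∈ gr (n + 1)
  d_d : ∀ x : V, d (d x) = 0

namespace DGStructure

variable {V : Type v} [AddCommGroup V] [Module K V] (s : DGStructure K V)

lemma iSup_gr : ⨆ n, s.gr n = ⊤ := s.isInternal.submodule_iSup_eq_top

lemma mem_iSup_gr (x : V) : x ∈ ⨆ n, s.gr n := by simp [s.iSup_gr]

lemma iSupIndep_gr : iSupIndep s.gr := s.isInternal.submodule_iSupIndep

/-- Induction over homogeneous elements. -/
lemma hom_induction {motive : V → Prop} (x : V)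
    (mem : ∀ n, ∀ x ∈ s.gr n, motive x) (zero : motive 0)
    (add : ∀ x y, motive x → motive y → motive (x + y)) : motive x :=
  Submodule.iSup_induction s.gr (motive := motive) (s.mem_iSup_gr x) mem zero add

/-- The identification of `V` with the external direct sum of its homogeneous components. -/
def decomp : V ≃ₗ[K] DirectSum ℤ (fun n => s.gr n) :=
  (LinearEquiv.ofBijective (DirectSum.coeLinearMap s.gr) s.isInternal).symm

lemma decomp_of_mem {n : ℤ} {x : V} (hx : x ∈ s.gr n) :
    s.decomp x = DirectSum.lof K ℤ (fun n => s.gr n) n ⟨x, hx⟩ := by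
  rw [decomp, LinearEquiv.symm_apply_eq]
  exact (DirectSum.coeLinearMap_lof s.gr n ⟨x, hx⟩).symm

/-- The projection onto the homogeneous component of degree `n`. -/
def proj (n : ℤ) : V →ₗ[K] V :=
  (s.gr n).subtype ∘ₗ DirectSum.component K ℤ (fun n => s.gr n) n ∘ₗ s.decomp.toLinearMap

lemma proj_of_mem {n : ℤ} {x : V} (hx : x ∈ s.gr n) : s.proj n x = x := by
  simp [proj, s.decomp_of_mem hx]

lemma proj_of_mem_ne {n m : ℤ} (h : n ≠ m) {x : V} (hx : x ∈ s.gr n) : s.proj m x = 0 := by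
  simp only [proj, LinearMap.comp_apply, LinearEquiv.coe_coe, s.decomp_of_mem hx,
    DirectSum.component.of, dif_neg h, map_zero]

/-- The degree involution: `x ↦ (-1)^{|x|} x` on homogeneous elements. -/
def sign : V →ₗ[K] V :=
  DirectSum.toModule K ℤ V (fun n => n.negOnePow • (s.gr n).subtype) ∘ₗ s.decomp.toLinearMap

lemma sign_of_mem {n : ℤ} {x : V} (hx : x ∈ s.gr n) : s.sign x = n.negOnePow • x := by
  simp [sign, s.decomp_of_mem hx]

lemma sign_sign (x : V) : s.sign (s.sign x) = x := by
  induction x using s.hom_induction with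
  | mem n x hx => rw [s.sign_of_mem hx, map_zsmul_unit, s.sign_of_mem hx, smul_smul]; simp
  | zero => simp
  | add x y hx hy => simp [hx, hy]

lemma sign_d (x : V) : s.sign (s.d x) = - s.d (s.sign x) := by
  induction x using s.hom_induction with
  | mem n x hx =>
    rw [s.sign_of_mem hx, map_zsmul_unit, s.sign_of_mem (s.d_mem hx), Int.negOnePow_succ,
      Units.smul_def, Units.smul_def, Units.val_neg, neg_smul]
  | zero => simp
  | add x y hx hy => simp [hx, hy]; abel

/-- An independent family of submodules that is stable under a differential makes its sum
a differential graded module. -/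
def ofIndep (p : ℤ → Submodule K V) (hp : iSupIndep p) (D : V →ₗ[K] V)
    (hD : ∀ n, ∀ x ∈ p n, D x ∈ p (n + 1)) (hDD : ∀ x ∈ ⨆ n, p n, D (D x) = 0) :
    DGStructure K ↥(⨆ n, p n) where
  gr n := (p n).comap (⨆ n, p n).subtype
  isInternal := by
    refine DirectSum.isInternal_submodule_of_iSupIndep_of_iSup_eq_top ?_ ?_
    · refine (iSupIndep_iff_finsetSum_eq_zero_imp_eq_zero _).2 fun t x hx h i hi => ?_
      have := (iSupIndep_iff_finsetSum_eq_zero_imp_eq_zero p).1 hp t (fun n => (x n : V))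
        hx (by simpa using congrArg Subtype.val h) i hi
      exact Subtype.ext this
    · refine eq_top_iff.2 fun x _ => ?_
      obtain ⟨x, hx⟩ := x
      refine Submodule.iSup_induction' p
        (motive := fun x hx => (⟨x, hx⟩ : ↥(⨆ n, p n)) ∈
          ⨆ n, (p n).comap (⨆ n, p n).subtype) ?_ ?_ ?_ hx
      · intro n x hx
        exact Submodule.mem_iSup_of_mem n hx
      · exact Submodule.zero_mem _
      · intro x y hx hy h1 h2
        exact Submodule.add_mem _ h1 h2
  d := D.restrict (p := ⨆ n, p n) (q := ⨆ n, p n) (fun x hx => by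
    induction hx using Submodule.iSup_induction' with
    | mem n x hx => exact Submodule.mem_iSup_of_mem _ (hD n x hx)
    | zero => simp
    | add x y hx hy h1 h2 => rw [map_add]; exact Submodule.add_mem _ h1 h2)
  d_mem {n x} hx := hD n _ hx
  d_d x := Subtype.ext (hDD _ x.2)

/-- The quotient of a differential graded module by a graded submodule that is stable under
the differential. -/
def quotient (W : Submodule K V) (hW : ∀ x ∈ W, x ∈ ⨆ n, s.gr n ⊓ W) (hd : ∀ x ∈ W, s.d x ∈ W) :
    DGStructure K (V ⧸ W) where
  gr n := (s.gr n).map W.mkQ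
  isInternal := by
    have hproj : ∀ n, ∀ x ∈ W, s.proj n x ∈ W := by
      intro n x hx
      have hx' := hW x hx
      clear hx
      induction hx' using Submodule.iSup_induction' with
      | mem m x hx =>
        by_cases h : m = n
        · subst h; rw [s.proj_of_mem hx.1]; exact hx.2
        · rw [s.proj_of_mem_ne h hx.1]; exact W.zero_mem
      | zero => simp
      | add x y _ _ h1 h2 => rw [map_add]; exact W.add_mem h1 h2
    refine DirectSum.isInternal_submodule_of_iSupIndep_of_iSup_eq_top ?_ ?_
    · refine (iSupIndep_iff_finsetSum_eq_zero_imp_eq_zero _).2 fun t x hx h i hi => ?_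
      have hx' : ∀ n, ∃ y, (n ∈ t → y ∈ s.gr n ∧ W.mkQ y = x n) := fun n => by
        by_cases hn : n ∈ t
        · obtain ⟨y, hy, hyx⟩ := hx n hn
          exact ⟨y, fun _ => ⟨hy, hyx⟩⟩
        · exact ⟨0, fun h => absurd h hn⟩
      choose y hy using hx'
      have h1 : ∑ n ∈ t, y n ∈ W := by
        rw [← Submodule.Quotient.mk_eq_zero, ← Submodule.mkQ_apply, map_sum, ← h]
        exact Finset.sum_congr rfl fun n hn => (hy n hn).2
      have h2 := hproj i _ h1
      rw [map_sum, Finset.sum_eq_single_of_mem i hi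
        (fun n hn hne => s.proj_of_mem_ne hne (hy n hn).1), s.proj_of_mem (hy i hi).1] at h2
      rw [← (hy i hi).2]
      simpa using h2
    · rw [← Submodule.map_iSup, s.iSup_gr, Submodule.map_top, Submodule.range_mkQ]
  d := W.mapQ W s.d hd
  d_mem := by
    rintro n _ ⟨x, hx, rfl⟩
    exact ⟨s.d x, s.d_mem hx, by simp⟩
  d_d x := by
    obtain ⟨x, rfl⟩ := W.mkQ_surjective x
    simp [s.d_d]

/-- Transport of the structure of a differential graded module along a linear equivalence. -/
def transport {V' : Type*} [AddCommGroup V'] [Module K V'] (e : V' ≃ₗ[K] V) :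
    DGStructure K V' where
  gr n := (s.gr n).comap e.toLinearMap
  isInternal := by
    refine DirectSum.isInternal_submodule_of_iSupIndep_of_iSup_eq_top ?_ ?_
    · refine (iSupIndep_iff_finsetSum_eq_zero_imp_eq_zero _).2 fun t x hx h i hi => ?_
      apply e.injective
      rw [map_zero]
      refine (iSupIndep_iff_finsetSum_eq_zero_imp_eq_zero _).1 s.iSupIndep_gr t
        (fun n => e (x n)) hx ?_ i hi
      rw [← map_sum, h, map_zero]
    · refine eq_top_iff.2 fun x _ => ?_
      have key : ∀ y : V, e.symm y ∈ ⨆ n, (s.gr n).comap e.toLinearMap := by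
        intro y
        induction y using s.hom_induction with
        | mem n y hy => exact Submodule.mem_iSup_of_mem n (by simpa using hy)
        | zero => rw [map_zero]; exact Submodule.zero_mem _
        | add y z h1 h2 => rw [map_add]; exact Submodule.add_mem _ h1 h2
      simpa using key (e x)
  d := e.symm.toLinearMap ∘ₗ s.d ∘ₗ e.toLinearMap
  d_mem {n x} hx := by simpa using s.d_mem hx
  d_d x := by simp [s.d_d]

end DGStructure

/-- A biadditive operation that is compatible with degrees preserves sums of homogeneous
components. -/
lemma biadd_mem_iSup {V₁ V₂ V₃ : Type*} [AddCommGroup V₁] [Module K V₁] [AddCommGroup V₂]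
    [Module K V₂] [AddCommGroup V₃] [Module K V₃] {p : ℤ → Submodule K V₁}
    {q : ℤ → Submodule K V₂} {r : ℤ → Submodule K V₃} (B : V₁ → V₂ → V₃)
    (hl : ∀ x x' y, B (x + x') y = B x y + B x' y) (hr : ∀ x y y', B x (y + y') = B x y + B x y')
    (h : ∀ i j, ∀ x ∈ p i, ∀ y ∈ q j, B x y ∈ r (i + j)) {x : V₁} {y : V₂}
    (hx : x ∈ ⨆ n, p n) (hy : y ∈ ⨆ n, q n) : B x y ∈ ⨆ n, r n := by
  have z1 : ∀ y, B 0 y = 0 := fun y => by simpa using hl 0 0 y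
  have z2 : ∀ x, B x 0 = 0 := fun x => by simpa using hr x 0 0
  induction hx using Submodule.iSup_induction' with
  | mem i x hx =>
    induction hy using Submodule.iSup_induction' with
    | mem j y hy => exact Submodule.mem_iSup_of_mem _ (h i j x hx y hy)
    | zero => rw [z2]; exact Submodule.zero_mem _
    | add y y' _ _ h1 h2 => rw [hr]; exact Submodule.add_mem _ h1 h2
  | zero => rw [z1]; exact Submodule.zero_mem _
  | add x x' _ _ h1 h2 => rw [hl]; exact Submodule.add_mem _ h1 h2

end Modules

/-! ### Dg-categories -/

/-- A dg-category over `K`: a `K`-linear category whose morphism modules are differential graded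
`K`-modules, such that composition is a morphism of degree zero commuting with the differentials,
that is, `|g ∘ f| = |g| + |f|` and `d (g ∘ f) = d g ∘ f + (-1)^{|g|} g ∘ d f`.
Recall that `f ≫ g` stands for `g ∘ f`. -/
class DGCategory (K : Type w) [CommRing K] (C : Type u) [Category.{v} C] [Preadditive C]
    [Linear K C] where
  /-- The differential graded module of morphisms. -/
  dg : ∀ X Y : C, DGStructure K (X ⟶ Y)
  id_mem : ∀ X : C, 𝟙 X ∈ (dg X X).gr 0
  comp_mem : ∀ {X Y Z : C} {m n : ℤ} {f : X ⟶ Y} {g : Y ⟶ Z},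
    f ∈ (dg X Y).gr m → g ∈ (dg Y Z).gr n → f ≫ g ∈ (dg X Z).gr (m + n)
  d_comp : ∀ {X Y Z : C} {n : ℤ} (f : X ⟶ Y) {g : Y ⟶ Z}, g ∈ (dg Y Z).gr n →
    (dg X Z).d (f ≫ g) = f ≫ (dg Y Z).d g + n.negOnePow • ((dg X Y).d f ≫ g)

/-- `Hom(X, Y)ⁿ`, the submodule of the homogeneous morphisms of degree `n`. -/
abbrev homDeg (K : Type w) [CommRing K] {C : Type u} [Category.{v} C] [Preadditive C]
    [Linear K C] [DGCategory K C] (X Y : C) (n : ℤ) : Submodule K (X ⟶ Y) :=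
  (DGCategory.dg (K := K) X Y).gr n

/-- The differential of the dg-module `Hom(X, Y)`. -/
abbrev homD (K : Type w) [CommRing K] {C : Type u} [Category.{v} C] [Preadditive C]
    [Linear K C] [DGCategory K C] {X Y : C} (f : X ⟶ Y) : X ⟶ Y :=
  (DGCategory.dg (K := K) X Y).d f

/-- Closed morphisms of degree zero. -/
def IsClosedZero (K : Type w) [CommRing K] {C : Type u} [Category.{v} C] [Preadditive C]
    [Linear K C] [DGCategory K C] {X Y : C} (f : X ⟶ Y) : Prop :=
  f ∈ homDeg K X Y 0 ∧ homD K f = 0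

/-! ### The dg-category of dg `K`-modules -/

/-- Differential graded `K`-modules. -/
structure DGModule (K : Type w) [CommRing K] where
  /-- The underlying `K`-module. -/
  carrier : Type v
  [addCommGroup : AddCommGroup carrier]
  [module : Module K carrier]
  /-- The grading and the differential. -/
  dg : DGStructure K carrier

namespace DGModule

attribute [instance] DGModule.addCommGroup DGModule.module

variable {K : Type w} [CommRing K]

/-- The `K`-linear maps `M → N` of degree `n`. -/
def homGr (M N : DGModule.{w, v} K) (n : ℤ) : Submodule K (M.carrier →ₗ[K] N.carrier) where
  carrier := {f | ∀ i, ∀ x ∈ M.dg.gr i, f x ∈ N.dg.gr (i + n)}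
  zero_mem' _ _ _ := Submodule.zero_mem _
  add_mem' hf hg i x hx := Submodule.add_mem _ (hf i x hx) (hg i x hx)
  smul_mem' c _ hf i x hx := Submodule.smul_mem _ c (hf i x hx)

lemma iSupIndep_homGr (M N : DGModule.{w, v} K) : iSupIndep (homGr M N) := by
  refine (iSupIndep_iff_finsetSum_eq_zero_imp_eq_zero _).2 fun t f hf h n hn => ?_
  ext x
  induction x using M.dg.hom_induction with
  | mem i x hx =>
    have h0 : N.dg.proj (i + n) ((∑ m ∈ t, f m) x) = f n x := by
      rw [LinearMap.sum_apply, map_sum, Finset.sum_eq_single_of_mem n hn,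
        N.dg.proj_of_mem (hf n hn i x hx)]
      intro m hm hne
      exact N.dg.proj_of_mem_ne (by omega) (hf m hm i x hx)
    rw [← h0, h]; simp
  | zero => simp
  | add x y hx hy => simpa using by rw [hx, hy]; simp

/-- The graded module `Hom(M, N) = ⨁ Homⁿ(M, N)`. -/
abbrev homTotal (M N : DGModule.{w, v} K) : Submodule K (M.carrier →ₗ[K] N.carrier) :=
  ⨆ n, homGr M N n

/-- The differential `d α = d ∘ α - (-1)^{|α|} α ∘ d` on linear maps; for a uniform formula, note
that `(-1)^{|α|} α = sign ∘ α ∘ sign` for a homogeneous map `α`, see `homDiff_of_mem`. -/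
def homDiff (M N : DGModule.{w, v} K) :
    (M.carrier →ₗ[K] N.carrier) →ₗ[K] (M.carrier →ₗ[K] N.carrier) where
  toFun f := N.dg.d ∘ₗ f - N.dg.sign ∘ₗ f ∘ₗ M.dg.sign ∘ₗ M.dg.d
  map_add' f g := by ext x; simp; abel
  map_smul' c f := by ext x; simp [smul_sub]

lemma sign_apply_of_mem {M N : DGModule.{w, v} K} {n : ℤ} {f : M.carrier →ₗ[K] N.carrier}
    (hf : f ∈ homGr M N n) (x : M.carrier) :
    N.dg.sign (f x) = n.negOnePow • f (M.dg.sign x) := by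
  induction x using M.dg.hom_induction with
  | mem i x hx =>
    rw [N.dg.sign_of_mem (hf i x hx), M.dg.sign_of_mem hx, map_zsmul_unit, smul_smul,
      Int.negOnePow_add, mul_comm]
  | zero => simp
  | add x y hx hy => simp [hx, hy]

lemma homDiff_of_mem {M N : DGModule.{w, v} K} {n : ℤ} {f : M.carrier →ₗ[K] N.carrier}
    (hf : f ∈ homGr M N n) :
    homDiff M N f = N.dg.d ∘ₗ f - n.negOnePow • (f ∘ₗ M.dg.d) := by
  ext x
  simp [homDiff, sign_apply_of_mem hf, M.dg.sign_sign]

lemma homDiff_mem {M N : DGModule.{w, v} K} {n : ℤ} {f : M.carrier →ₗ[K] N.carrier}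
    (hf : f ∈ homGr M N n) : homDiff M N f ∈ homGr M N (n + 1) := by
  rw [homDiff_of_mem hf]
  refine Submodule.sub_mem _ ?_ ?_
  · intro i x hx
    have := N.dg.d_mem (hf i x hx)
    rwa [add_assoc] at this
  · rw [Units.smul_def]
    refine zsmul_mem (S := Submodule K _) ?_ _
    intro i x hx
    have := hf (i + 1) _ (M.dg.d_mem hx)
    rwa [add_assoc, add_comm 1 n] at this

lemma homDiff_homDiff {M N : DGModule.{w, v} K} (f : M.carrier →ₗ[K] N.carrier) :
    homDiff M N (homDiff M N f) = 0 := by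
  ext x
  simp [homDiff, N.dg.d_d, M.dg.d_d, N.dg.sign_d, M.dg.sign_d]

/-- The morphisms of dg `K`-modules: finite sums of homogeneous `K`-linear maps. -/
@[ext]
structure Hom (M N : DGModule.{w, v} K) where
  /-- The underlying linear map. -/
  lin : M.carrier →ₗ[K] N.carrier
  mem : lin ∈ homTotal M N

/-- The identification of `Hom M N` with the submodule `homTotal M N`. -/
def homEquiv (M N : DGModule.{w, v} K) : Hom M N ≃ homTotal M N where
  toFun f := ⟨f.lin, f.mem⟩
  invFun f := ⟨f.1, f.2⟩

instance : Category.{v} (DGModule.{w, v} K) where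
  Hom M N := Hom M N
  id M := ⟨LinearMap.id, Submodule.mem_iSup_of_mem 0 fun i x hx => by simpa using hx⟩
  comp {M N P} f g := ⟨g.lin ∘ₗ f.lin, biadd_mem_iSup (p := homGr M N) (q := homGr N P)
    (r := homGr M P) (fun f g => g ∘ₗ f)
    (fun _ _ _ => LinearMap.comp_add _ _ _) (fun _ _ _ => LinearMap.add_comp _ _ _)
    (fun m n f hf g hg i x hx => by
      have := hg (i + m) _ (hf i x hx)
      rwa [add_assoc] at this) f.mem g.mem⟩

@[ext]
lemma hom_ext {M N : DGModule.{w, v} K} {f g : M ⟶ N} (h : f.lin = g.lin) : f = g := Hom.ext h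

@[simp]
lemma id_lin (M : DGModule.{w, v} K) : Hom.lin (𝟙 M) = LinearMap.id := rfl

@[simp]
lemma comp_lin {M N P : DGModule.{w, v} K} (f : M ⟶ N) (g : N ⟶ P) :
    (f ≫ g).lin = g.lin ∘ₗ f.lin := rfl

instance : Preadditive (DGModule.{w, v} K) where
  homGroup M N := (homEquiv M N).addCommGroup
  add_comp _ _ _ _ _ _ := Hom.ext (LinearMap.comp_add _ _ _)
  comp_add _ _ _ _ _ _ := Hom.ext (LinearMap.add_comp _ _ _)

instance : Linear K (DGModule.{w, v} K) where
  homModule M N := (homEquiv M N).module K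
  smul_comp _ _ _ _ _ _ := Hom.ext (LinearMap.comp_smul _ _ _)
  comp_smul _ _ _ _ _ _ := Hom.ext (LinearMap.smul_comp _ _ _)

/-- `homEquiv` as a linear equivalence. -/
def homLinearEquiv (M N : DGModule.{w, v} K) : (M ⟶ N) ≃ₗ[K] homTotal M N where
  __ := homEquiv M N
  map_add' _ _ := rfl
  map_smul' _ _ := rfl

/-- The dg-module structure on `Hom(M, N)`. -/
def homDG (M N : DGModule.{w, v} K) : DGStructure K (M ⟶ N) :=
  (DGStructure.ofIndep (homGr M N) (iSupIndep_homGr M N) (homDiff M N)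
    (fun _ _ h => homDiff_mem h) (fun f _ => homDiff_homDiff f)).transport (homLinearEquiv M N)

/-- The dg-category of dg `K`-modules. -/
instance : DGCategory K (DGModule.{w, v} K) where
  dg := homDG
  id_mem M := fun i x hx => by rw [add_zero]; exact hx
  comp_mem {M N P m n f g} hf hg := fun i x hx => by
    have := hg (i + m) _ (hf i x hx)
    rwa [add_assoc] at this
  d_comp {M N P n} f g hg := by
    refine Hom.ext ?_
    change homDiff M P (g.lin ∘ₗ f.lin) =
      homDiff N P g.lin ∘ₗ f.lin + n.negOnePow • (g.lin ∘ₗ homDiff M N f.lin)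
    have hg' : g.lin ∈ homGr N P n := hg
    rw [homDiff_of_mem hg']
    ext x
    simp [homDiff, sign_apply_of_mem hg', smul_sub]

lemma mem_homDeg_iff {M N : DGModule.{w, v} K} {n : ℤ} (f : M ⟶ N) :
    f ∈ homDeg K M N n ↔ ∀ i, ∀ x ∈ M.dg.gr i, f.lin x ∈ N.dg.gr (i + n) := Iff.rfl

lemma homD_lin {M N : DGModule.{w, v} K} {n : ℤ} {f : M ⟶ N} (hf : f ∈ homDeg K M N n) :
    (homD K f).lin = N.dg.d ∘ₗ f.lin - n.negOnePow • (f.lin ∘ₗ M.dg.d) :=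
  homDiff_of_mem hf

end DGModule

/-! ### Dg-functors and dg-natural transformations -/

section Functors

variable (K : Type w) [CommRing K]
variable (C : Type u₁) [Category.{v₁} C] [Preadditive C] [Linear K C] [DGCategory K C]
variable (D : Type u₂) [Category.{v₂} D] [Preadditive D] [Linear K D] [DGCategory K D]
variable (E : Type u₃) [Category.{v₃} E] [Preadditive E] [Linear K E] [DGCategory K E]

/-- Dg-functors: `K`-linear functors that preserve degrees and commute with the differentials. -/
structure DGFunctor extends C ⥤ D where
  map_add : ∀ {X Y : C} (f g : X ⟶ Y), map (f + g) = map f + map g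
  map_smul : ∀ {X Y : C} (c : K) (f : X ⟶ Y), map (c • f) = c • map f
  map_mem : ∀ {X Y : C} {n : ℤ} {f : X ⟶ Y},
    f ∈ homDeg K X Y n → map f ∈ homDeg K (obj X) (obj Y) n
  map_d : ∀ {X Y : C} (f : X ⟶ Y), map (homD K f) = homD K (map f)

variable {K C D E}

namespace DGFunctor

/-- The composition of dg-functors: first `F`, then `G`. -/
def comp (F : DGFunctor K C D) (G : DGFunctor K D E) : DGFunctor K C E where
  toFunctor := F.toFunctor ⋙ G.toFunctor
  map_add f g := by simp [F.map_add, G.map_add]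
  map_smul c f := by simp [F.map_smul, G.map_smul]
  map_mem h := G.map_mem (F.map_mem h)
  map_d f := by simp [F.map_d, G.map_d]

/-- `DgNatⁿ(F, G)`: the families `η_X ∈ Hom(F X, G X)ⁿ` such that
`G(f) ∘ η_X = (-1)^{nm} η_Y ∘ F(f)` for every homogeneous `f : X ⟶ Y` of degree `m`. -/
def natGr (F G : DGFunctor K C D) (n : ℤ) : Submodule K (∀ X : C, F.obj X ⟶ G.obj X) where
  carrier := {η | (∀ X, η X ∈ homDeg K (F.obj X) (G.obj X) n) ∧
    ∀ (m : ℤ) (X Y : C) (f : X ⟶ Y), f ∈ homDeg K X Y m →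
      η X ≫ G.map f = (n * m).negOnePow • (F.map f ≫ η Y)}
  zero_mem' := ⟨fun _ => Submodule.zero_mem _, fun m X Y f _ => by simp⟩
  add_mem' h1 h2 := ⟨fun X => Submodule.add_mem _ (h1.1 X) (h2.1 X), fun m X Y f hf => by
    simp [h1.2 m X Y f hf, h2.2 m X Y f hf]⟩
  smul_mem' c η h := ⟨fun X => Submodule.smul_mem _ c (h.1 X), fun m X Y f hf => by
    simp [h.2 m X Y f hf, smul_comm c]⟩

lemma iSupIndep_natGr (F G : DGFunctor K C D) : iSupIndep (natGr F G) := by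
  refine (iSupIndep_iff_finsetSum_eq_zero_imp_eq_zero _).2 fun t f hf h n hn => ?_
  ext X
  refine (iSupIndep_iff_finsetSum_eq_zero_imp_eq_zero _).1
    (DGCategory.dg (K := K) (F.obj X) (G.obj X)).iSupIndep_gr t (fun m => f m X)
    (fun m hm => (hf m hm).1 X) ?_ n hn
  simpa using congrFun h X

/-- `DgNat(F, G) = ⨁ DgNatⁿ(F, G)`, realised inside the product of the `Hom(F X, G X)`. -/
abbrev natTotal (F G : DGFunctor K C D) : Submodule K (∀ X : C, F.obj X ⟶ G.obj X) :=
  ⨆ n, natGr F G n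

/-- The componentwise differential `d(η)_X = d(η_X)`. -/
def natDiff (F G : DGFunctor K C D) :
    (∀ X : C, F.obj X ⟶ G.obj X) →ₗ[K] (∀ X : C, F.obj X ⟶ G.obj X) where
  toFun η X := homD K (η X)
  map_add' η θ := by ext X; simp
  map_smul' c η := by ext X; simp

lemma natDiff_mem {F G : DGFunctor K C D} {n : ℤ} {η : ∀ X : C, F.obj X ⟶ G.obj X}
    (hη : η ∈ natGr F G n) : natDiff F G η ∈ natGr F G (n + 1) := by
  refine ⟨fun X => DGStructure.d_mem _ (hη.1 X), fun m X Y f hf => ?_⟩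
  change homD K (η X) ≫ G.map f = _ • (F.map f ≫ homD K (η Y))
  have h1 := congrArg (homD K) (hη.2 m X Y f hf)
  have h2 := hη.2 (m + 1) X Y (homD K f) (DGStructure.d_mem _ hf)
  simp only [homD, map_zsmul_unit] at h1
  rw [DGCategory.d_comp _ (G.map_mem hf), DGCategory.d_comp _ (hη.1 Y)] at h1
  have e1 := F.map_d f
  have e2 := G.map_d f
  simp only [homD] at e1 e2 h2 ⊢
  rw [← e1, ← e2, h2, smul_add, smul_smul, mul_add, mul_one, Int.negOnePow_add,
    add_comm] at h1
  have h3 := add_right_cancel h1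
  have h4 := congrArg (fun z => m.negOnePow • z) h3
  simp only [smul_smul] at h4
  rw [← Int.negOnePow_add, ← Int.negOnePow_add, Int.negOnePow_even _ (Even.add_self m), one_smul] at h4
  rw [h4]
  congr 2
  ring

/-- The dg-natural transformations from `F` to `G`. -/
@[ext]
structure Hom (F G : DGFunctor K C D) where
  /-- The component at `X` of a dg-natural transformation. -/
  app : ∀ X : C, F.obj X ⟶ G.obj X
  mem : app ∈ natTotal F G

/-- The identification of `Hom F G` with the submodule `natTotal F G`. -/
def homEquiv (F G : DGFunctor K C D) : Hom F G ≃ natTotal F G where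
  toFun η := ⟨η.app, η.mem⟩
  invFun η := ⟨η.1, η.2⟩

lemma id_mem_natGr (F : DGFunctor K C D) : (fun X => 𝟙 (F.obj X)) ∈ natGr F F 0 :=
  ⟨fun X => DGCategory.id_mem _, fun m X Y f hf => by simp⟩

lemma comp_mem_natGr {F G H : DGFunctor K C D} {i j : ℤ} {η : ∀ X : C, F.obj X ⟶ G.obj X}
    {θ : ∀ X : C, G.obj X ⟶ H.obj X} (hη : η ∈ natGr F G i) (hθ : θ ∈ natGr G H j) :
    (fun X => η X ≫ θ X) ∈ natGr F H (i + j) :=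
  ⟨fun X => DGCategory.comp_mem (hη.1 X) (hθ.1 X), fun m X Y f hf => by
    dsimp only
    rw [Category.assoc, hθ.2 m X Y f hf, Units.smul_def, Preadditive.comp_zsmul,
      ← Category.assoc, hη.2 m X Y f hf, Units.smul_def, Preadditive.zsmul_comp,
      ← Units.smul_def, ← Units.smul_def, smul_smul, Category.assoc, ← Int.negOnePow_add]
    congr 2
    ring⟩

/-- The dg-functors `C → D` with the dg-natural transformations form the category
`DgFun(C, D)`. -/
instance : Category (DGFunctor K C D) where
  Hom F G := Hom F G
  id F := ⟨fun X => 𝟙 (F.obj X), Submodule.mem_iSup_of_mem 0 (id_mem_natGr F)⟩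
  comp {F G H} η θ := ⟨fun X => η.app X ≫ θ.app X, biadd_mem_iSup
    (p := natGr F G) (q := natGr G H) (r := natGr F H)
    (fun (η : ∀ X : C, F.obj X ⟶ G.obj X) (θ : ∀ X : C, G.obj X ⟶ H.obj X) X => η X ≫ θ X)
    (fun η η' θ => by ext X; simp) (fun η θ θ' => by ext X; simp)
    (fun i j η hη θ hθ => comp_mem_natGr hη hθ) η.mem θ.mem⟩
  id_comp η := Hom.ext (by ext X; simp)
  comp_id η := Hom.ext (by ext X; simp)
  assoc η θ κ := Hom.ext (by ext X; simp)

@[ext]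
lemma hom_ext {F G : DGFunctor K C D} {η θ : F ⟶ G} (h : ∀ X, η.app X = θ.app X) : η = θ :=
  Hom.ext (funext h)

@[simp]
lemma id_app (F : DGFunctor K C D) (X : C) : Hom.app (𝟙 F) X = 𝟙 (F.obj X) := rfl

@[simp]
lemma comp_app {F G H : DGFunctor K C D} (η : F ⟶ G) (θ : G ⟶ H) (X : C) :
    (η ≫ θ).app X = η.app X ≫ θ.app X := rfl

instance : Preadditive (DGFunctor K C D) where
  homGroup F G := (homEquiv F G).addCommGroup
  add_comp _ _ _ _ _ _ := Hom.ext (by ext X; exact Preadditive.add_comp _ _ _ _ _ _)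
  comp_add _ _ _ _ _ _ := Hom.ext (by ext X; exact Preadditive.comp_add _ _ _ _ _ _)

instance : Linear K (DGFunctor K C D) where
  homModule F G := (homEquiv F G).module K
  smul_comp _ _ _ _ _ _ := Hom.ext (by ext X; exact Linear.smul_comp _ _ _ _ _ _)
  comp_smul _ _ _ _ _ _ := Hom.ext (by ext X; exact Linear.comp_smul _ _ _ _ _ _)

/-- `homEquiv` as a linear equivalence. -/
def homLinearEquiv (F G : DGFunctor K C D) : (F ⟶ G) ≃ₗ[K] natTotal F G where
  __ := homEquiv F G
  map_add' _ _ := rfl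
  map_smul' _ _ := rfl

/-- The dg-module structure on `DgNat(F, G)`. -/
def natDG (F G : DGFunctor K C D) : DGStructure K (F ⟶ G) :=
  (DGStructure.ofIndep (natGr F G) (iSupIndep_natGr F G) (natDiff F G)
    (fun _ _ h => natDiff_mem h) (fun η _ => by
      ext X; exact (DGCategory.dg (K := K) (F.obj X) (G.obj X)).d_d (η X))).transport
    (homLinearEquiv F G)

/-- The dg-category `DgFun(C, D)`. -/
instance : DGCategory K (DGFunctor K C D) where
  dg := natDG
  id_mem F := id_mem_natGr F
  comp_mem hη hθ := comp_mem_natGr hη hθ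
  d_comp {F G H n} η θ hθ := by
    ext X
    have hθ' : θ.app ∈ natGr G H n := hθ
    exact DGCategory.d_comp (K := K) (η.app X) (hθ'.1 X)

lemma mem_homDeg_iff {F G : DGFunctor K C D} {n : ℤ} (η : F ⟶ G) :
    η ∈ homDeg K F G n ↔ η.app ∈ natGr F G n := Iff.rfl

lemma homD_app {F G : DGFunctor K C D} (η : F ⟶ G) (X : C) :
    (homD K η).app X = homD K (η.app X) := rfl

end DGFunctor

/-- A dg-functor is dg-fully faithful if the morphisms of dg-modules
`Hom(X, Y) → Hom(F X, F Y)` (of degree zero, commuting with the differentials) are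
isomorphisms, that is, bijective. -/
def DGFunctor.IsFullyFaithful (F : DGFunctor K C D) : Prop :=
  ∀ X Y : C, Function.Bijective (fun f : X ⟶ Y => F.map f)

/-- A dg-adjunction between `L` and `R`: isomorphisms of dg-modules `Hom(L X, Y) ≅ Hom(X, R Y)`
natural in `X` and `Y`. -/
structure DGAdjunction (L : DGFunctor K C D) (R : DGFunctor K D C) where
  /-- The isomorphism `Hom(L X, Y) ≅ Hom(X, R Y)`. -/
  equiv : ∀ (X : C) (Y : D), (L.obj X ⟶ Y) ≃ₗ[K] (X ⟶ R.obj Y)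
  equiv_mem : ∀ {X : C} {Y : D} {n : ℤ} (f : L.obj X ⟶ Y),
    equiv X Y f ∈ homDeg K X (R.obj Y) n ↔ f ∈ homDeg K (L.obj X) Y n
  equiv_d : ∀ {X : C} {Y : D} (f : L.obj X ⟶ Y), equiv X Y (homD K f) = homD K (equiv X Y f)
  naturality : ∀ {X X' : C} {Y Y' : D} (a : X' ⟶ X) (f : L.obj X ⟶ Y) (b : Y ⟶ Y'),
    equiv X' Y' (L.map a ≫ f ≫ b) = a ≫ equiv X Y f ≫ R.map b

/-- `(L, R)` is a dg-adjoint pair. -/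
def IsDGAdjoint (L : DGFunctor K C D) (R : DGFunctor K D C) : Prop := Nonempty (DGAdjunction L R)

/-- The kernel of a dg-functor: the objects sent to zero objects. -/
def DGFunctor.ker (F : DGFunctor K C D) : ObjectProperty C := fun X => IsZero (F.obj X)

/-- The essential image of a dg-functor: the objects isomorphic to some `F Y`. -/
def DGFunctor.im (F : DGFunctor K C D) : ObjectProperty D :=
  fun X => ∃ Y : C, Nonempty (F.obj Y ≅ X)

/-- The essential image of a dg-functor up to closed isomorphisms of degree zero. -/
def DGFunctor.closedIm (F : DGFunctor K C D) : ObjectProperty D :=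
  fun X => ∃ (Y : C) (e : F.obj Y ≅ X), IsClosedZero K e.hom ∧ IsClosedZero K e.inv

end Functors

/-- A recollement of dg-categories `C → D → E`: dg-adjoint triples `(iL, i, iR)` and
`(jL, j, jR)` such that the essential image of `i` is the kernel of `j` and such that `i`, `jL`
and `jR` are dg-fully faithful. -/
structure IsDGRecollement {K : Type w} [CommRing K]
    {C : Type u₁} [Category.{v₁} C] [Preadditive C] [Linear K C] [DGCategory K C]
    {D : Type u₂} [Category.{v₂} D] [Preadditive D] [Linear K D] [DGCategory K D]
    {E : Type u₃} [Category.{v₃} E] [Preadditive E] [Linear K E] [DGCategory K E]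
    (iL : DGFunctor K D C) (i : DGFunctor K C D) (iR : DGFunctor K D C)
    (jL : DGFunctor K E D) (j : DGFunctor K D E) (jR : DGFunctor K E D) : Prop where
  adj_iL_i : IsDGAdjoint iL i
  adj_i_iR : IsDGAdjoint i iR
  adj_jL_j : IsDGAdjoint jL j
  adj_j_jR : IsDGAdjoint j jR
  im_eq_ker : i.im = j.ker
  closedIm_eq_ker : i.closedIm = j.ker
  i_fullyFaithful : i.IsFullyFaithful
  jL_fullyFaithful : jL.IsFullyFaithful
  jR_fullyFaithful : jR.IsFullyFaithful

/-! ### Dg-modules over a dg-category, restriction and Kan extensions -/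

section DgMod

variable (K : Type w) [CommRing K]
variable (A : Type u₁) [Category.{v₁} A] [Preadditive A] [Linear K A] [DGCategory K A]
variable {C : Type u₂} [Category.{v₂} C] [Preadditive C] [Linear K C] [DGCategory K C]

/-- The dg-category `DgMod(A) = DgFun(A, DgMod(K))` of left dg `A`-modules. -/
abbrev DgMod := DGFunctor K A (DGModule.{w, v} K)

variable {K A}

/-- Restriction along a dg-functor `F : A → C`: the dg-functor `F_* : DgMod(C) → DgMod(A)` with
`F_*(S) = S ∘ F`. -/
def restrict (F : DGFunctor K A C) : DGFunctor K (DgMod.{w, v} K C) (DgMod.{w, v} K A) where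
  obj S := F.comp S
  map {S T} η := ⟨fun X => η.app (F.obj X), by
    have h := η.mem
    generalize η.app = η at h
    induction h using Submodule.iSup_induction' with
    | mem n η hη =>
      exact Submodule.mem_iSup_of_mem n
        ⟨fun X => hη.1 (F.obj X), fun m X Y f hf => hη.2 m _ _ _ (F.map_mem hf)⟩
    | zero => exact Submodule.zero_mem _
    | add η θ _ _ h1 h2 => exact Submodule.add_mem _ h1 h2⟩
  map_add _ _ := rfl
  map_smul _ _ := rfl
  map_mem {S T n η} hη := by
    have hη' : η.app ∈ DGFunctor.natGr S T n := hη
    exact ⟨fun X => hη'.1 (F.obj X), fun m X Y f hf => hη'.2 m _ _ _ (F.map_mem hf)⟩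
  map_d _ := rfl

/-- `S` together with `φ : G → S ∘ F` is a left Kan extension of the dg-module `G` along `F`:
`φ` is closed of degree zero and, for all `X` in `C` and all dg `K`-modules `B`, the map
`Hom(S X, B) → DgNat(C(F -, X), Hom(G -, B))` which sends `β` to the family
`τ_Y (f) = β ∘ S(f) ∘ φ_Y` is an isomorphism, in every degree `n`.
The dg-natural transformations of degree `n` between these two right dg `A`-modules are the
families `τ` of `K`-linear maps of degree `n` with `τ (f ∘ F a) = τ (f) ∘ G a`: the signs
`(-1)^{|a| |f|}` and `(-1)^{|a| (|f| + n)}` of the right actions and the sign `(-1)^{|a| n}` of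
dg-naturality cancel. -/
structure IsLeftKanExtension (F : DGFunctor K A C) (G : DgMod.{w, v} K A) (S : DgMod.{w, v} K C)
    (φ : G ⟶ (restrict F).obj S) : Prop where
  closedZero : IsClosedZero K φ
  bijective : ∀ (X : C) (B : DGModule.{w, v} K) (n : ℤ)
    (τ : ∀ Y : A, (F.obj Y ⟶ X) →ₗ[K] (G.obj Y ⟶ B)),
    (∀ (Y : A) (p : ℤ) (f : F.obj Y ⟶ X), f ∈ homDeg K (F.obj Y) X p →
      τ Y f ∈ homDeg K (G.obj Y) B (p + n)) →
    (∀ (Y Y' : A) (a : Y ⟶ Y') (f : F.obj Y' ⟶ X), τ Y (F.map a ≫ f) = G.map a ≫ τ Y' f) →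
    ∃! β : S.obj X ⟶ B, β ∈ homDeg K (S.obj X) B n ∧
      ∀ (Y : A) (f : F.obj Y ⟶ X), τ Y f = φ.app Y ≫ S.map f ≫ β

/-- `T` together with `ψ : T ∘ F → G` is a right Kan extension of the dg-module `G` along `F`:
`ψ` is closed of degree zero and, for all `X` in `C` and all dg `K`-modules `B`, the map
`Hom(B, T X) → DgNat(C(X, F -), Hom(B, G -))` which sends `β` to the family
`τ_Y (f) = (-1)^{|β| |f|} ψ_Y ∘ T(f) ∘ β` is an isomorphism, in every degree `n`. -/
structure IsRightKanExtension (F : DGFunctor K A C) (G : DgMod.{w, v} K A) (T : DgMod.{w, v} K C)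
    (ψ : (restrict F).obj T ⟶ G) : Prop where
  closedZero : IsClosedZero K ψ
  bijective : ∀ (X : C) (B : DGModule.{w, v} K) (n : ℤ)
    (τ : ∀ Y : A, (X ⟶ F.obj Y) →ₗ[K] (B ⟶ G.obj Y)),
    (∀ (Y : A) (p : ℤ) (f : X ⟶ F.obj Y), f ∈ homDeg K X (F.obj Y) p →
      τ Y f ∈ homDeg K B (G.obj Y) (p + n)) →
    (∀ (m : ℤ) (Y Y' : A) (a : Y ⟶ Y') (f : X ⟶ F.obj Y), a ∈ homDeg K Y Y' m →
      τ Y f ≫ G.map a = (n * m).negOnePow • τ Y' (f ≫ F.map a)) →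
    ∃! β : B ⟶ T.obj X, β ∈ homDeg K B (T.obj X) n ∧
      ∀ (Y : A) (p : ℤ) (f : X ⟶ F.obj Y), f ∈ homDeg K X (F.obj Y) p →
        τ Y f = (n * p).negOnePow • (β ≫ T.map f ≫ ψ.app Y)

/-- `L : DgMod(A) → DgMod(C)` is the left Kan extension functor `Lan_F(-)`: the modules `L(G)`
are left Kan extensions of `G` along `F`, with units that are natural in `G`. -/
def IsLanFunctor (F : DGFunctor K A C) (L : DGFunctor K (DgMod.{w, v} K A) (DgMod.{w, v} K C)) :
    Prop :=
  ∃ φ : ∀ G : DgMod.{w, v} K A, G ⟶ (restrict F).obj (L.obj G),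
    (∀ G, IsLeftKanExtension F G (L.obj G) (φ G)) ∧
    ∀ (G G' : DgMod.{w, v} K A) (η : G ⟶ G'), φ G ≫ (restrict F).map (L.map η) = η ≫ φ G'

/-- `R : DgMod(A) → DgMod(C)` is the right Kan extension functor `Ran_F(-)`: the modules `R(G)`
are right Kan extensions of `G` along `F`, with counits that are natural in `G`. -/
def IsRanFunctor (F : DGFunctor K A C) (R : DGFunctor K (DgMod.{w, v} K A) (DgMod.{w, v} K C)) :
    Prop :=
  ∃ ψ : ∀ G : DgMod.{w, v} K A, (restrict F).obj (R.obj G) ⟶ G,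
    (∀ G, IsRightKanExtension F G (R.obj G) (ψ G)) ∧
    ∀ (G G' : DgMod.{w, v} K A) (η : G ⟶ G'), (restrict F).map (R.map η) ≫ ψ G' = ψ G ≫ η

end DgMod

/-! ### Full dg-subcategories -/

section FullSubcategory

variable {K : Type w} [CommRing K] {C : Type u} [Category.{v} C] [Preadditive C] [Linear K C]
  [DGCategory K C] (P : ObjectProperty C)

/-- The morphisms of a full subcategory are the morphisms of the ambient category. -/
def fullHomEquiv (K : Type w) [CommRing K] [Linear K C] (X Y : P.FullSubcategory) :
    (X ⟶ Y) ≃ₗ[K] (X.obj ⟶ Y.obj) where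
  toFun f := f.hom
  invFun f := P.homMk f
  map_add' _ _ := rfl
  map_smul' _ _ := rfl

/-- A full subcategory of a dg-category is a dg-category, with the same dg-modules of
morphisms. -/
instance : DGCategory K P.FullSubcategory where
  dg X Y := (DGCategory.dg (K := K) X.obj Y.obj).transport (fullHomEquiv P K X Y)
  id_mem X := DGCategory.id_mem X.obj
  comp_mem hf hg := DGCategory.comp_mem (K := K) (C := C) hf hg
  d_comp {X Y Z n} f g hg := by
    refine InducedCategory.hom_ext ?_
    have h := DGCategory.d_comp (K := K) (C := C) f.hom (g := g.hom) (n := n) hg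
    rw [Units.smul_def] at h ⊢
    exact h

/-- The inclusion of a full dg-subcategory. -/
def inclusion : DGFunctor K P.FullSubcategory C where
  toFunctor := P.ι
  map_add _ _ := rfl
  map_smul _ _ := rfl
  map_mem h := h
  map_d _ := rfl

/-- The full subcategory given by `P` is closed under finite coproducts: a coproduct of finitely
many objects satisfying `P` is isomorphic to an object satisfying `P`. -/
def ClosedUnderFiniteCoproducts [HasFiniteCoproducts C] : Prop :=
  ∀ (ι : Type) [Finite ι] (X : ι → C), (∀ i, P (X i)) → ∃ B, P B ∧ Nonempty (∐ X ≅ B)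

end FullSubcategory

/-! ### Dg-ideals and quotients -/

section Ideals

/-- Dg-ideals of a dg-category. -/
structure DGIdeal (K : Type w) [CommRing K] (C : Type u) [Category.{v} C] [Preadditive C]
    [Linear K C] [DGCategory K C] where
  /-- The morphisms `X ⟶ Y` that belong to the ideal. -/
  sub : ∀ X Y : C, Submodule K (X ⟶ Y)
  graded : ∀ {X Y : C} (f : X ⟶ Y), f ∈ sub X Y → f ∈ ⨆ n, homDeg K X Y n ⊓ sub X Y
  d_mem : ∀ {X Y : C} (f : X ⟶ Y), f ∈ sub X Y → homD K f ∈ sub X Y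
  comp_mem : ∀ {X' X Y Y' : C} (g : X' ⟶ X) (f : X ⟶ Y) (h : Y ⟶ Y'), f ∈ sub X Y →
    g ≫ f ≫ h ∈ sub X' Y'

variable {K : Type w} [CommRing K] {C : Type u} [Category.{v} C] [Preadditive C] [Linear K C]
  [DGCategory K C]

/-- The quotient `C / I` of a dg-category by a dg-ideal; it has the same objects as `C`. -/
structure DGQuotient (I : DGIdeal K C) where
  /-- The underlying object of `C`. -/
  as : C

namespace DGQuotient

variable (I : DGIdeal K C)

lemma comp_mem_left {X Y Z : C} (g : X ⟶ Y) {f : Y ⟶ Z} (hf : f ∈ I.sub Y Z) :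
    g ≫ f ∈ I.sub X Z := by
  simpa using I.comp_mem g f (𝟙 Z) hf

lemma comp_mem_right {X Y Z : C} {f : X ⟶ Y} (h : Y ⟶ Z) (hf : f ∈ I.sub X Y) :
    f ≫ h ∈ I.sub X Z := by
  simpa using I.comp_mem (𝟙 X) f h hf

/-- Composition of residue classes. -/
def compQ (X Y Z : C) : ((X ⟶ Y) ⧸ I.sub X Y) →ₗ[K] ((Y ⟶ Z) ⧸ I.sub Y Z) →ₗ[K]
    ((X ⟶ Z) ⧸ I.sub X Z) :=
  (I.sub X Y).liftQ
    { toFun := fun f => (I.sub Y Z).mapQ (I.sub X Z) (Linear.leftComp K Z f)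
        (fun _ hg => comp_mem_left I f hg)
      map_add' := fun f f' => Submodule.linearMap_qext _ (LinearMap.ext fun g =>
        congrArg (I.sub X Z).mkQ (Preadditive.add_comp X Y Z f f' g))
      map_smul' := fun c f => Submodule.linearMap_qext _ (LinearMap.ext fun g =>
        congrArg (I.sub X Z).mkQ (Linear.smul_comp X Y Z c f g)) }
    (fun _ hf => Submodule.linearMap_qext _ (LinearMap.ext fun g =>
      (Submodule.Quotient.mk_eq_zero _).2 (comp_mem_right I g hf)))

lemma compQ_mk {X Y Z : C} (f : X ⟶ Y) (g : Y ⟶ Z) :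
    compQ I X Y Z ((I.sub X Y).mkQ f) ((I.sub Y Z).mkQ g) = (I.sub X Z).mkQ (f ≫ g) := rfl

instance : Category.{v} (DGQuotient I) where
  Hom X Y := (X.as ⟶ Y.as) ⧸ I.sub X.as Y.as
  id X := (I.sub X.as X.as).mkQ (𝟙 X.as)
  comp {X Y Z} f g := compQ I X.as Y.as Z.as f g
  id_comp {X Y} f := by
    obtain ⟨f, rfl⟩ := (I.sub _ _).mkQ_surjective f
    rw [compQ_mk, Category.id_comp]
  comp_id {X Y} f := by
    obtain ⟨f, rfl⟩ := (I.sub _ _).mkQ_surjective f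
    rw [compQ_mk, Category.comp_id]
  assoc {W X Y Z} f g h := by
    obtain ⟨f, rfl⟩ := (I.sub _ _).mkQ_surjective f
    obtain ⟨g, rfl⟩ := (I.sub _ _).mkQ_surjective g
    obtain ⟨h, rfl⟩ := (I.sub _ _).mkQ_surjective h
    simp only [compQ_mk, Category.assoc]

instance : Preadditive (DGQuotient I) where
  homGroup X Y := inferInstanceAs (AddCommGroup ((X.as ⟶ Y.as) ⧸ I.sub X.as Y.as))
  add_comp X Y Z f f' g := LinearMap.map_add₂ (compQ I X.as Y.as Z.as) f f' g
  comp_add X Y Z f g g' := (compQ I X.as Y.as Z.as f).map_add g g'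

instance : Linear K (DGQuotient I) where
  homModule X Y := inferInstanceAs (Module K ((X.as ⟶ Y.as) ⧸ I.sub X.as Y.as))
  smul_comp X Y Z c f g := LinearMap.map_smul₂ (compQ I X.as Y.as Z.as) c f g
  comp_smul X Y Z f c g := (compQ I X.as Y.as Z.as f).map_smul c g

/-- The residue class of a morphism. -/
def cls {X Y : C} (f : X ⟶ Y) : (⟨X⟩ : DGQuotient I) ⟶ ⟨Y⟩ := (I.sub X Y).mkQ f

lemma cls_comp {X Y Z : C} (f : X ⟶ Y) (g : Y ⟶ Z) : cls I (f ≫ g) = cls I f ≫ cls I g := rfl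

instance : DGCategory K (DGQuotient I) where
  dg X Y := (DGCategory.dg (K := K) X.as Y.as).quotient (I.sub X.as Y.as)
    (fun f hf => I.graded f hf) (fun f hf => I.d_mem f hf)
  id_mem X := ⟨𝟙 X.as, DGCategory.id_mem X.as, rfl⟩
  comp_mem := by
    rintro X Y Z m n _ _ ⟨f, hf, rfl⟩ ⟨g, hg, rfl⟩
    exact ⟨f ≫ g, DGCategory.comp_mem hf hg, rfl⟩
  d_comp := by
    rintro X Y Z n f _ ⟨g, hg, rfl⟩
    obtain ⟨f, rfl⟩ := (I.sub _ _).mkQ_surjective f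
    have h := congrArg (cls I) (DGCategory.d_comp (K := K) f hg)
    rw [Units.smul_def] at h ⊢
    exact h

/-- The projection `π : C → C / I`. -/
def proj : DGFunctor K C (DGQuotient I) where
  obj X := ⟨X⟩
  map f := cls I f
  map_id _ := rfl
  map_comp _ _ := rfl
  map_add _ _ := rfl
  map_smul _ _ := rfl
  map_mem {_ _ _ f} hf := ⟨f, hf, rfl⟩
  map_d _ := rfl

end DGQuotient

/-! ### The ideal of the maps that factor through a full subcategory -/

variable [HasFiniteCoproducts C] {P : ObjectProperty C}

/-- `I_B(X, Y)ⁿ`: the morphisms of degree `n` of the form `h ∘ g` with `g : X ⟶ B`, `h : B ⟶ Y`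
(not necessarily homogeneous) and `B` satisfying `P`. -/
def factorGr (K : Type w) [CommRing K] [Linear K C] [DGCategory K C]
    (hP : ClosedUnderFiniteCoproducts P) (X Y : C) (n : ℤ) : Submodule K (X ⟶ Y) where
  carrier := {f | f ∈ homDeg K X Y n ∧ ∃ B, P B ∧ ∃ (g : X ⟶ B) (h : B ⟶ Y), f = g ≫ h}
  zero_mem' := by
    obtain ⟨B, hB, -⟩ := hP PEmpty PEmpty.elim (fun i => i.elim)
    exact ⟨Submodule.zero_mem _, B, hB, 0, 0, by simp⟩
  add_mem' := by
    rintro f₁ f₂ ⟨h1, B₁, hB₁, g₁, k₁, rfl⟩ ⟨h2, B₂, hB₂, g₂, k₂, rfl⟩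
    obtain ⟨B, hB, ⟨e⟩⟩ := hP Bool (fun b => cond b B₁ B₂) (by rintro (_ | _) <;> assumption)
    refine ⟨Submodule.add_mem _ h1 h2, B, hB,
      g₁ ≫ Sigma.ι (fun b => cond b B₁ B₂) true ≫ e.hom +
        g₂ ≫ Sigma.ι (fun b => cond b B₁ B₂) false ≫ e.hom,
      e.inv ≫ Sigma.desc (fun b => match b with
        | true => k₁
        | false => k₂), ?_⟩
    simp [Preadditive.add_comp]
  smul_mem' := by
    rintro c f ⟨h1, B, hB, g, k, rfl⟩
    exact ⟨Submodule.smul_mem _ c h1, B, hB, c • g, k, by simp⟩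

lemma comp_mem_factor (hP : ClosedUnderFiniteCoproducts P) {X B Y : C} (hB : P B) (g : X ⟶ B)
    (h : B ⟶ Y) : g ≫ h ∈ ⨆ n, factorGr K hP X Y n :=
  biadd_mem_iSup (p := homDeg K X B) (q := homDeg K B Y) (r := factorGr K hP X Y) (fun g h => g ≫ h) (by simp) (by simp)
    (fun _ _ g hg h hh => ⟨DGCategory.comp_mem hg hh, B, hB, g, h, rfl⟩)
    (DGStructure.mem_iSup_gr _ g) (DGStructure.mem_iSup_gr _ h)

/-- The dg-ideal `I_B = ⨁ I_Bⁿ` of the maps that factor through the full subcategory given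
by `P`. -/
def factorIdeal (K : Type w) [CommRing K] [Linear K C] [DGCategory K C]
    (hP : ClosedUnderFiniteCoproducts P) : DGIdeal K C where
  sub X Y := ⨆ n, factorGr K hP X Y n
  graded {X Y} f hf := by
    refine (iSup_mono fun n => ?_ : ⨆ n, factorGr K hP X Y n ≤ _) hf
    exact le_inf (fun f hf => hf.1) (le_iSup (factorGr K hP X Y) n)
  d_mem {X Y} f hf := by
    induction hf using Submodule.iSup_induction' with
    | mem n f hf =>
      obtain ⟨-, B, hB, g, h, rfl⟩ := hf
      induction h using (DGCategory.dg (K := K) B Y).hom_induction with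
      | mem m h hh =>
        rw [homD, DGCategory.d_comp _ hh, Units.smul_def]
        exact Submodule.add_mem _ (comp_mem_factor hP hB _ _)
          (zsmul_mem (comp_mem_factor hP hB _ _) _)
      | zero => simp
      | add h h' h1 h2 =>
        rw [Preadditive.comp_add, homD, map_add]
        exact Submodule.add_mem _ h1 h2
    | zero => simp
    | add f f' _ _ h1 h2 => rw [homD, map_add]; exact Submodule.add_mem _ h1 h2
  comp_mem {X' X Y Y'} g f h hf := by
    induction hf using Submodule.iSup_induction' with
    | mem n f hf =>
      obtain ⟨-, B, hB, a, b, rfl⟩ := hf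
      have := comp_mem_factor (K := K) hP hB (g ≫ a) (b ≫ h)
      simpa using this
    | zero => simp
    | add f f' _ _ h1 h2 =>
      rw [Preadditive.add_comp, Preadditive.comp_add]; exact Submodule.add_mem _ h1 h2

end Ideals

end DG

end

noncomputable section

namespace DG

/-! ### Graded linear maps -/

namespace DGStructure

variable {K : Type w} [CommRing K] {V : Type v} [AddCommGroup V] [Module K V]
  {V' : Type u} [AddCommGroup V'] [Module K V'] (s : DGStructure K V) (s' : DGStructure K V')

/-! Adjointness and full faithfulness of `j_!` and `j_*` are formal consequences of pointwise
enriched Kan extensions; only the identification of image and kernel uses the ideal.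

For a dg-functor `F : A → C` with `A` small, the value of `Lan_F G` at `X` is the tensor product
over `A` of `C(F -, X)` with `G`, and the value of `Ran_F G` is the graded module of `A`-linear
families `C(X, F -) → G` (`lan`, `ran`). Their universal properties at each object
(`exists_isLeftKanExtension`, `exists_isRightKanExtension`) are those of the tensor product and of
currying. Pointwise universality gives universal arrows for `restrict F` (`isUniversalFrom`,
`isUniversalTo`): the components produced object by object are natural because maps out of `Lan` are
tested on the elements `S(f) φ_Y(x)`, and maps into `Ran` through the evaluations `ψ_Y ∘ T(f)`.
Closed universal arrows of degree zero assemble into dg-adjoints.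

If `F` is fully faithful, the pointwise property applied to `F(f) ↦ G(f)` inverts the unit and the
counit (`isIso_unit`, `isIso_counit`), which makes both Kan extension functors fully faithful. This
is used for the inclusion `j`.

For the projection `π`, objects are unchanged and every homogeneous class lifts to a homogeneous
morphism, so naturality over the quotient and over `C` coincide and `π_*` is fully faithful. A
module `M` is strictly restricted from the quotient as soon as it kills the ideal. It does so if
`1_{M(B)} = 0` for all `B` in the subcategory, since `M(h ∘ g) = M(h) ∘ 1_{M(B)} ∘ M(g)`; conversely
`1_B` lies in the ideal, so a module isomorphic to a restricted one has `1_{M(B)} = 0`. Hence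
essential image ≤ kernel ≤ closed essential image ≤ essential image, and all three agree.

The delicate point is signs. Identities are proved on homogeneous elements and extended additively,
or written with the degree involution so that they hold for all elements. -/

lemma units_smul_mem (p : Submodule K V) (ε : ℤˣ) {x : V} (hx : x ∈ p) : ε • x ∈ p := by
  rw [Units.smul_def]
  exact zsmul_mem hx _

/-- The linear map with prescribed restrictions to the homogeneous components. -/
def lift (φ : ∀ n, s.gr n →ₗ[K] V') : V →ₗ[K] V' :=
  DirectSum.toModule K ℤ V' φ ∘ₗ s.decomp.toLinearMap

lemma lift_of_mem (φ : ∀ n, s.gr n →ₗ[K] V') {n : ℤ} {x : V} (hx : x ∈ s.gr n) :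
    s.lift φ x = φ n ⟨x, hx⟩ := by
  simp [lift, s.decomp_of_mem hx]

lemma linearMap_ext {f g : V →ₗ[K] V'} (h : ∀ n, ∀ x ∈ s.gr n, f x = g x) : f = g := by
  ext x
  induction x using s.hom_induction with
  | mem n x hx => exact h n x hx
  | zero => simp
  | add x y hx hy => simp [hx, hy]

lemma sign_mem {n : ℤ} {x : V} (hx : x ∈ s.gr n) : s.sign x ∈ s.gr n := by
  rw [s.sign_of_mem hx]
  exact units_smul_mem _ _ hx

/-- The `n`-th power of the degree involution. -/
def signPow (n : ℤ) : V →ₗ[K] V := if Even n then LinearMap.id else s.sign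

/-- Twisting a family by `(-1)^{n|f|}` must give a `K`-linear map in `f`, also on inhomogeneous `f`.
Only the parity of `n` matters, so the identity or the involution realises the twist. -/
lemma signPow_of_mem (n : ℤ) {p : ℤ} {x : V} (hx : x ∈ s.gr p) :
    s.signPow n x = (n * p).negOnePow • x := by
  unfold signPow
  split_ifs with h
  · rw [Int.negOnePow_even _ (h.mul_right p), one_smul, LinearMap.id_apply]
  · rw [s.sign_of_mem hx]
    congr 1
    rcases Int.even_or_odd p with hp | hp
    · rw [Int.negOnePow_even _ hp, Int.negOnePow_even _ (hp.mul_left n)]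
    · rw [Int.negOnePow_odd _ hp, Int.negOnePow_odd _ ((Int.not_even_iff_odd.1 h).mul hp)]

lemma proj_mem (n : ℤ) (x : V) : s.proj n x ∈ s.gr n := Subtype.property _

lemma eq_zero_of_proj {x : V} (h : ∀ n, s.proj n x = 0) : x = 0 := by
  refine s.decomp.injective ?_
  rw [map_zero]
  exact DFinsupp.ext fun n => Subtype.ext (h n)

lemma proj_map {T : V →ₗ[K] V'} (hT : ∀ n, ∀ x ∈ s.gr n, T x ∈ s'.gr n) (n : ℤ) (x : V) :
    s'.proj n (T x) = T (s.proj n x) := by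
  refine LinearMap.congr_fun (s.linearMap_ext (f := s'.proj n ∘ₗ T) (g := T ∘ₗ s.proj n)
    fun m x hx => ?_) x
  by_cases h : m = n
  · subst h
    simp [s.proj_of_mem hx, s'.proj_of_mem (hT m x hx)]
  · simp [s.proj_of_mem_ne h hx, s'.proj_of_mem_ne h (hT m x hx)]

/-- An injective map of graded modules reflects degrees. -/
lemma mem_of_map_mem {T : V →ₗ[K] V'} (hT : ∀ n, ∀ x ∈ s.gr n, T x ∈ s'.gr n)
    (hinj : Function.Injective T) {n : ℤ} {x : V} (hx : T x ∈ s'.gr n) : x ∈ s.gr n := by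
  have h := s.proj_map s' hT n x
  rw [s'.proj_of_mem hx] at h
  rw [hinj h]
  exact s.proj_mem n x

/-- A map of graded modules that is bijective in every degree is bijective. -/
lemma bijective_of_existsUnique {T : V →ₗ[K] V'} (hT : ∀ n, ∀ x ∈ s.gr n, T x ∈ s'.gr n)
    (h : ∀ n, ∀ y ∈ s'.gr n, ∃! x, x ∈ s.gr n ∧ T x = y) : Function.Bijective T := by
  constructor
  -- `T` commutes with the projections, so the homogeneous components of a kernel element are again
  -- in the kernel; uniqueness over `0` kills each of them.
  · refine (injective_iff_map_eq_zero T).2 fun x hx => s.eq_zero_of_proj fun n => ?_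
    have h0 : T (s.proj n x) = 0 := by rw [← s.proj_map s' hT, hx, map_zero]
    exact (h n 0 (Submodule.zero_mem _)).unique ⟨s.proj_mem n x, h0⟩
      ⟨Submodule.zero_mem _, map_zero T⟩
  · intro y
    induction y using s'.hom_induction with
    | mem n y hy =>
      obtain ⟨x, ⟨-, hx⟩, -⟩ := h n y hy
      exact ⟨x, hx⟩
    | zero => exact ⟨0, map_zero T⟩
    | add y y' h1 h2 =>
      obtain ⟨x, rfl⟩ := h1
      obtain ⟨x', rfl⟩ := h2
      exact ⟨x + x', map_add T x x'⟩

end DGStructure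

/-! ### Closed morphisms of degree zero and the Leibniz rule -/

section Closed

variable {K : Type w} [CommRing K]
  {C : Type u₁} [Category.{v₁} C] [Preadditive C] [Linear K C] [DGCategory K C]
  {D : Type u₂} [Category.{v₂} D] [Preadditive D] [Linear K D] [DGCategory K D]

/-- The Leibniz sign `(-1)^{|g|}` sits on the term containing `d f`, which vanishes. What remains is
linear in `g`, so `g` need not be homogeneous. -/
lemma homD_closedZero_comp {X Y Z : C} {f : X ⟶ Y} (hf : IsClosedZero K f) (g : Y ⟶ Z) :
    homD K (f ≫ g) = f ≫ homD K g := by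
  refine LinearMap.congr_fun ((DGCategory.dg (K := K) Y Z).linearMap_ext
    (f := (DGCategory.dg (K := K) X Z).d ∘ₗ Linear.leftComp K Z f)
    (g := Linear.leftComp K Z f ∘ₗ (DGCategory.dg (K := K) Y Z).d) fun n g hg => ?_) g
  have h : (DGCategory.dg (K := K) X Y).d f = 0 := hf.2
  simp [DGCategory.d_comp f hg, h]

lemma homD_comp_closedZero {X Y Z : C} (f : X ⟶ Y) {g : Y ⟶ Z} (hg : IsClosedZero K g) :
    homD K (f ≫ g) = homD K f ≫ g := by
  have h : (DGCategory.dg (K := K) Y Z).d g = 0 := hg.2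
  simp [homD, DGCategory.d_comp f hg.1, h]

lemma IsClosedZero.comp_mem {X Y Z : C} {f : X ⟶ Y} (hf : IsClosedZero K f) {n : ℤ} {g : Y ⟶ Z}
    (hg : g ∈ homDeg K Y Z n) : f ≫ g ∈ homDeg K X Z n := by
  have := DGCategory.comp_mem hf.1 hg
  rwa [zero_add] at this

lemma IsClosedZero.mem_comp {X Y Z : C} {n : ℤ} {f : X ⟶ Y} (hf : f ∈ homDeg K X Y n) {g : Y ⟶ Z}
    (hg : IsClosedZero K g) : f ≫ g ∈ homDeg K X Z n := by
  have := DGCategory.comp_mem hf hg.1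
  rwa [add_zero] at this

/-- The action of a dg-functor on a module of morphisms. -/
def DGFunctor.mapLinear (F : DGFunctor K C D) (X Y : C) : (X ⟶ Y) →ₗ[K] (F.obj X ⟶ F.obj Y) where
  toFun f := F.map f
  map_add' := F.map_add
  map_smul' := F.map_smul

lemma DGFunctor.map_zero (F : DGFunctor K C D) (X Y : C) : F.map (0 : X ⟶ Y) = 0 :=
  (F.mapLinear X Y).map_zero

lemma DGFunctor.map_units_smul (F : DGFunctor K C D) {X Y : C} (ε : ℤˣ) (f : X ⟶ Y) :
    F.map (ε • f) = ε • F.map f :=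
  map_zsmul_unit (F.mapLinear X Y) ε f

/-! ### Dg-adjoints from universal arrows -/

/-- A universal closed arrow of degree zero from `X` to the dg-functor `R`. -/
structure IsUniversalFrom (R : DGFunctor K D C) (X : C) (L : D) (φ : X ⟶ R.obj L) : Prop where
  closedZero : IsClosedZero K φ
  existsUnique : ∀ (Y : D) (n : ℤ) (f : X ⟶ R.obj Y), f ∈ homDeg K X (R.obj Y) n →
    ∃! g : L ⟶ Y, g ∈ homDeg K L Y n ∧ φ ≫ R.map g = f

/-- A universal closed arrow of degree zero from the dg-functor `L` to `Y`. -/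
structure IsUniversalTo (L : DGFunctor K C D) (Y : D) (R : C) (ψ : L.obj R ⟶ Y) : Prop where
  closedZero : IsClosedZero K ψ
  existsUnique : ∀ (X : C) (n : ℤ) (f : L.obj X ⟶ Y), f ∈ homDeg K (L.obj X) Y n →
    ∃! g : X ⟶ R, g ∈ homDeg K X R n ∧ L.map g ≫ ψ = f

namespace IsUniversalFrom

variable {R : DGFunctor K D C} {X : C} {L : D} {φ : X ⟶ R.obj L} (h : IsUniversalFrom R X L φ)
include h

lemma map_mem (Y : D) (n : ℤ) (g : L ⟶ Y) (hg : g ∈ homDeg K L Y n) :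
    (Linear.leftComp K _ φ ∘ₗ R.mapLinear L Y) g ∈ homDeg K X (R.obj Y) n :=
  h.closedZero.comp_mem (R.map_mem hg)

/-- The isomorphism `Hom(L, Y) ≅ Hom(X, R Y)`. -/
def equiv (Y : D) : (L ⟶ Y) ≃ₗ[K] (X ⟶ R.obj Y) :=
  LinearEquiv.ofBijective (Linear.leftComp K _ φ ∘ₗ R.mapLinear L Y)
    (DGStructure.bijective_of_existsUnique _ _ (h.map_mem Y) (h.existsUnique Y))

lemma equiv_apply {Y : D} (g : L ⟶ Y) : h.equiv Y g = φ ≫ R.map g := rfl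

lemma equiv_mem {Y : D} {n : ℤ} (g : L ⟶ Y) :
    h.equiv Y g ∈ homDeg K X (R.obj Y) n ↔ g ∈ homDeg K L Y n :=
  ⟨fun hg => DGStructure.mem_of_map_mem _ _ (h.map_mem Y) (h.equiv Y).injective hg,
    h.map_mem Y n g⟩

lemma equiv_d {Y : D} (g : L ⟶ Y) : h.equiv Y (homD K g) = homD K (h.equiv Y g) := by
  simp only [equiv_apply]
  rw [R.map_d, homD_closedZero_comp h.closedZero]

/-- Stated for any `l` lying over `a` with respect to the universal arrows. For the left adjoint
constructed below, `l` is its value on `a`, and this becomes naturality of the adjunction. -/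
lemma equiv_naturality {X' : C} {L' : D} {φ' : X' ⟶ R.obj L'} (h' : IsUniversalFrom R X' L' φ')
    {a : X' ⟶ X} {l : L' ⟶ L} (hl : φ' ≫ R.map l = a ≫ φ) {Y Y' : D} (f : L ⟶ Y) (b : Y ⟶ Y') :
    h'.equiv Y' (l ≫ f ≫ b) = a ≫ h.equiv Y f ≫ R.map b := by
  rw [h'.equiv_apply, h.equiv_apply, R.map_comp, ← Category.assoc, hl, R.map_comp]
  simp only [Category.assoc]

end IsUniversalFrom

namespace IsUniversalTo

variable {L : DGFunctor K C D} {Y : D} {R : C} {ψ : L.obj R ⟶ Y} (h : IsUniversalTo L Y R ψ)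
include h

lemma map_mem (X : C) (n : ℤ) (g : X ⟶ R) (hg : g ∈ homDeg K X R n) :
    (Linear.rightComp K _ ψ ∘ₗ L.mapLinear X R) g ∈ homDeg K (L.obj X) Y n :=
  h.closedZero.mem_comp (L.map_mem hg)

/-- The isomorphism `Hom(X, R) ≅ Hom(L X, Y)`. -/
def equiv (X : C) : (X ⟶ R) ≃ₗ[K] (L.obj X ⟶ Y) :=
  LinearEquiv.ofBijective (Linear.rightComp K _ ψ ∘ₗ L.mapLinear X R)
    (DGStructure.bijective_of_existsUnique _ _ (h.map_mem X) (h.existsUnique X))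

lemma equiv_apply {X : C} (g : X ⟶ R) : h.equiv X g = L.map g ≫ ψ := rfl

lemma equiv_mem {X : C} {n : ℤ} (g : X ⟶ R) :
    h.equiv X g ∈ homDeg K (L.obj X) Y n ↔ g ∈ homDeg K X R n :=
  ⟨fun hg => DGStructure.mem_of_map_mem _ _ (h.map_mem X) (h.equiv X).injective hg,
    h.map_mem X n g⟩

lemma equiv_d {X : C} (g : X ⟶ R) : h.equiv X (homD K g) = homD K (h.equiv X g) := by
  simp only [equiv_apply]
  rw [L.map_d, homD_comp_closedZero _ h.closedZero]

lemma equiv_symm_mem {X : C} {n : ℤ} (f : L.obj X ⟶ Y) :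
    (h.equiv X).symm f ∈ homDeg K X R n ↔ f ∈ homDeg K (L.obj X) Y n := by
  rw [← h.equiv_mem, LinearEquiv.apply_symm_apply]

lemma equiv_symm_d {X : C} (f : L.obj X ⟶ Y) :
    (h.equiv X).symm (homD K f) = homD K ((h.equiv X).symm f) := by
  rw [LinearEquiv.symm_apply_eq, h.equiv_d, LinearEquiv.apply_symm_apply]

/-- Dual to `IsUniversalFrom.equiv_naturality`, with `r` in the role of the right adjoint applied to
`b`. The inverse appears because a universal arrow to `Y` naturally gives `Hom(X, R) ≅ Hom(L X, Y)`,
opposite to the direction in `DGAdjunction`. -/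
lemma equiv_symm_naturality {Y' : D} {R' : C} {ψ' : L.obj R' ⟶ Y'} (h' : IsUniversalTo L Y' R' ψ')
    {b : Y ⟶ Y'} {r : R ⟶ R'} (hr : L.map r ≫ ψ' = ψ ≫ b) {X X' : C} (a : X' ⟶ X)
    (f : L.obj X ⟶ Y) :
    (h'.equiv X').symm (L.map a ≫ f ≫ b) = a ≫ (h.equiv X).symm f ≫ r := by
  rw [LinearEquiv.symm_apply_eq, h'.equiv_apply, L.map_comp, L.map_comp, Category.assoc,
    Category.assoc, hr]
  conv_lhs => rw [← (h.equiv X).apply_symm_apply f, h.equiv_apply]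
  simp only [Category.assoc]

end IsUniversalTo

section LeftAdjoint

variable {R : DGFunctor K D C} {L : C → D} {φ : ∀ X, X ⟶ R.obj (L X)}
  (h : ∀ X, IsUniversalFrom R X (L X) (φ X))

/-- The left dg-adjoint given by universal arrows. -/
def leftAdjointOfUniversal : DGFunctor K C D where
  obj := L
  map {X Y} f := ((h X).equiv (L Y)).symm (f ≫ φ Y)
  map_id X := by
    rw [LinearEquiv.symm_apply_eq, (h X).equiv_apply]
    simp
  map_comp {X Y Z} f g := by
    rw [LinearEquiv.symm_apply_eq, (h X).equiv_apply, R.map_comp, ← Category.assoc,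
      ← (h X).equiv_apply, LinearEquiv.apply_symm_apply, Category.assoc, Category.assoc,
      ← (h Y).equiv_apply, LinearEquiv.apply_symm_apply]
  map_add f g := by simp
  map_smul c f := by simp
  map_mem {X Y n f} hf := by
    -- `equiv` reflects degrees, so the degree may be read off after applying it.
    rw [← (h X).equiv_mem, LinearEquiv.apply_symm_apply]
    exact (h Y).closedZero.mem_comp hf
  map_d {X Y} f := by
    rw [LinearEquiv.symm_apply_eq, (h X).equiv_d, LinearEquiv.apply_symm_apply,
      homD_comp_closedZero _ (h Y).closedZero]

lemma unit_leftAdjointOfUniversal {X Y : C} (f : X ⟶ Y) :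
    φ X ≫ R.map ((leftAdjointOfUniversal h).map f) = f ≫ φ Y :=
  ((h X).equiv (L Y)).apply_symm_apply (f ≫ φ Y)

lemma isDGAdjoint_leftAdjointOfUniversal : IsDGAdjoint (leftAdjointOfUniversal h) R :=
  ⟨{ equiv := fun X Y => (h X).equiv Y
     equiv_mem := fun {X _ _} f => (h X).equiv_mem f
     equiv_d := fun {X _} f => (h X).equiv_d f
     naturality := fun {X X' _ _} a f b =>
      (h X).equiv_naturality (h X') (unit_leftAdjointOfUniversal h a) f b }⟩

/-- On morphisms the left adjoint is postcomposition with `φ Y` followed by the inverse of the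
adjunction bijection, and the first factor is bijective when `φ Y` is invertible. -/
lemma isFullyFaithful_leftAdjointOfUniversal (hφ : ∀ X, IsIso (φ X)) :
    (leftAdjointOfUniversal h).IsFullyFaithful := fun X Y =>
  ((h X).equiv (L Y)).symm.bijective.comp
    ⟨fun _ _ hfg => (cancel_mono (φ Y)).1 hfg, fun g => ⟨g ≫ inv (φ Y), by simp⟩⟩

end LeftAdjoint

section RightAdjoint

variable {L : DGFunctor K C D} {R : D → C} {ψ : ∀ Y, L.obj (R Y) ⟶ Y}
  (h : ∀ Y, IsUniversalTo L Y (R Y) (ψ Y))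

/-- The right dg-adjoint given by universal arrows. -/
def rightAdjointOfUniversal : DGFunctor K D C where
  obj := R
  map {X Y} f := ((h Y).equiv (R X)).symm (ψ X ≫ f)
  map_id X := by
    rw [LinearEquiv.symm_apply_eq, (h X).equiv_apply]
    simp
  map_comp {X Y Z} f g := by
    rw [LinearEquiv.symm_apply_eq, (h Z).equiv_apply, L.map_comp, Category.assoc,
      ← (h Z).equiv_apply, LinearEquiv.apply_symm_apply, ← Category.assoc, ← Category.assoc,
      ← (h Y).equiv_apply, LinearEquiv.apply_symm_apply]
  map_add f g := by simp
  map_smul c f := by simp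
  map_mem {X Y n f} hf := by
    rw [← (h Y).equiv_mem, LinearEquiv.apply_symm_apply]
    exact (h X).closedZero.comp_mem hf
  map_d {X Y} f := by
    rw [LinearEquiv.symm_apply_eq, (h Y).equiv_d, LinearEquiv.apply_symm_apply,
      homD_closedZero_comp (h X).closedZero]

lemma counit_rightAdjointOfUniversal {X Y : D} (f : X ⟶ Y) :
    L.map ((rightAdjointOfUniversal h).map f) ≫ ψ Y = ψ X ≫ f :=
  ((h Y).equiv (R X)).apply_symm_apply (ψ X ≫ f)

lemma isDGAdjoint_rightAdjointOfUniversal : IsDGAdjoint L (rightAdjointOfUniversal h) :=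
  ⟨{ equiv := fun X Y => ((h Y).equiv X).symm
     equiv_mem := fun {_ Y _} f => (h Y).equiv_symm_mem f
     equiv_d := fun {_ Y} f => (h Y).equiv_symm_d f
     naturality := fun {_ _ Y Y'} a f b =>
      (h Y).equiv_symm_naturality (h Y') (counit_rightAdjointOfUniversal h b) a f }⟩

lemma isFullyFaithful_rightAdjointOfUniversal (hψ : ∀ Y, IsIso (ψ Y)) :
    (rightAdjointOfUniversal h).IsFullyFaithful := fun X Y =>
  ((h Y).equiv (R X)).symm.bijective.comp
    ⟨fun _ _ hfg => (cancel_epi (ψ X)).1 hfg, fun g => ⟨inv (ψ X) ≫ g, by simp⟩⟩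

end RightAdjoint

end Closed

/-! ### Universal properties of Kan extensions -/

section Naturality

variable {K : Type w} [CommRing K]
  {C : Type u₁} [Category.{v₁} C] [Preadditive C] [Linear K C] [DGCategory K C]
  {D : Type u₂} [Category.{v₂} D] [Preadditive D] [Linear K D] [DGCategory K D]

/-- In degree zero the sign `(-1)^{0·|f|}` is trivial for every homogeneous `f`, so naturality is a
linear condition in `f` and extends to all morphisms. -/
lemma DGFunctor.naturality_of_mem_zero {F G : DGFunctor K C D} {η : F ⟶ G}
    (hη : η ∈ homDeg K F G 0) {X Y : C} (f : X ⟶ Y) :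
    η.app X ≫ G.map f = F.map f ≫ η.app Y := by
  have hη' : η.app ∈ DGFunctor.natGr F G 0 := hη
  refine LinearMap.congr_fun ((DGCategory.dg (K := K) X Y).linearMap_ext
    (f := Linear.leftComp K _ (η.app X) ∘ₗ G.mapLinear X Y)
    (g := Linear.rightComp K _ (η.app Y) ∘ₗ F.mapLinear X Y) fun m f hf => ?_) f
  have := hη'.2 m X Y f hf
  rw [zero_mul, Int.negOnePow_zero, one_smul] at this
  exact this

lemma DGFunctor.app_mem {F G : DGFunctor K C D} {n : ℤ} {η : F ⟶ G} (hη : η ∈ homDeg K F G n)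
    (X : C) : η.app X ∈ homDeg K (F.obj X) (G.obj X) n :=
  have hη' : η.app ∈ DGFunctor.natGr F G n := hη
  hη'.1 X

lemma DGFunctor.naturality_of_mem {F G : DGFunctor K C D} {n : ℤ} {η : F ⟶ G}
    (hη : η ∈ homDeg K F G n) {m : ℤ} {X Y : C} {f : X ⟶ Y} (hf : f ∈ homDeg K X Y m) :
    η.app X ≫ G.map f = (n * m).negOnePow • (F.map f ≫ η.app Y) :=
  have hη' : η.app ∈ DGFunctor.natGr F G n := hη
  hη'.2 m X Y f hf

lemma DGFunctor.isClosedZero_app {F G : DGFunctor K C D} {η : F ⟶ G} (hη : IsClosedZero K η)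
    (X : C) : IsClosedZero K (η.app X) :=
  ⟨DGFunctor.app_mem hη.1 X, by
    have h := DGFunctor.homD_app (K := K) η X
    rw [hη.2] at h
    exact h.symm⟩

/-- A dg-natural transformation of degree zero is invertible if its components are invertible
by morphisms of degree zero. -/
lemma DGFunctor.isIso_of_app {F G : DGFunctor K C D} {η : F ⟶ G} (hη : η ∈ homDeg K F G 0)
    (β : ∀ X, G.obj X ⟶ F.obj X) (hβ : ∀ X, β X ∈ homDeg K (G.obj X) (F.obj X) 0)
    (h1 : ∀ X, η.app X ≫ β X = 𝟙 _) (h2 : ∀ X, β X ≫ η.app X = 𝟙 _) : IsIso η := by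
  have hmem : β ∈ DGFunctor.natGr G F 0 := by
    refine ⟨hβ, fun m X Y f _ => ?_⟩
    rw [zero_mul, Int.negOnePow_zero, one_smul]
    calc β X ≫ F.map f = β X ≫ (F.map f ≫ η.app Y) ≫ β Y := by
          rw [Category.assoc, h1, Category.comp_id]
      _ = G.map f ≫ β Y := by
          rw [← DGFunctor.naturality_of_mem_zero hη, ← Category.assoc, ← Category.assoc, h2,
            Category.id_comp]
  exact ⟨⟨β, Submodule.mem_iSup_of_mem 0 hmem⟩, DGFunctor.hom_ext h1, DGFunctor.hom_ext h2⟩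

/-- The inverse of a fully faithful dg-functor on modules of morphisms. -/
def DGFunctor.IsFullyFaithful.mapEquiv {F : DGFunctor K C D} (hF : F.IsFullyFaithful) (X Y : C) :
    (X ⟶ Y) ≃ₗ[K] (F.obj X ⟶ F.obj Y) :=
  LinearEquiv.ofBijective (F.mapLinear X Y) (hF X Y)

lemma DGFunctor.IsFullyFaithful.mapEquiv_apply {F : DGFunctor K C D} (hF : F.IsFullyFaithful)
    {X Y : C} (f : X ⟶ Y) : hF.mapEquiv X Y f = F.map f := rfl

/-- Full faithfulness only asks for bijectivity, but an injective graded map reflects degrees, so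
its inverse is graded too. -/
lemma DGFunctor.IsFullyFaithful.mapEquiv_symm_mem {F : DGFunctor K C D} (hF : F.IsFullyFaithful)
    {X Y : C} {n : ℤ} {f : F.obj X ⟶ F.obj Y} (hf : f ∈ homDeg K (F.obj X) (F.obj Y) n) :
    (hF.mapEquiv X Y).symm f ∈ homDeg K X Y n :=
  DGStructure.mem_of_map_mem _ (DGCategory.dg (K := K) (F.obj X) (F.obj Y))
    (T := F.mapLinear X Y) (fun _ _ h => F.map_mem h) (hF X Y).1
    (((hF.mapEquiv X Y).apply_symm_apply f).symm ▸ hf)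

end Naturality

section KanExtensions

variable {K : Type w} [CommRing K]
  {A : Type u₁} [Category.{v₁} A] [Preadditive A] [Linear K A] [DGCategory K A]
  {C : Type u₂} [Category.{v₂} C] [Preadditive C] [Linear K C] [DGCategory K C]
  {F : DGFunctor K A C} {G : DgMod.{w, v} K A}

/-- The components of a morphism to a restricted dg-module. -/
def unitApp {S : DgMod.{w, v} K C} (φ : G ⟶ (restrict F).obj S) (Y : A) :
    G.obj Y ⟶ S.obj (F.obj Y) := φ.app Y

/-- The components of a morphism from a restricted dg-module. -/
def counitApp {T : DgMod.{w, v} K C} (ψ : (restrict F).obj T ⟶ G) (Y : A) :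
    T.obj (F.obj Y) ⟶ G.obj Y := ψ.app Y

lemma unitApp_ext {S : DgMod.{w, v} K C} {φ φ' : G ⟶ (restrict F).obj S}
    (h : ∀ Y, unitApp φ Y = unitApp φ' Y) : φ = φ' := DGFunctor.hom_ext h

lemma counitApp_ext {T : DgMod.{w, v} K C} {ψ ψ' : (restrict F).obj T ⟶ G}
    (h : ∀ Y, counitApp ψ Y = counitApp ψ' Y) : ψ = ψ' := DGFunctor.hom_ext h

section

variable {S : DgMod.{w, v} K C} {n m : ℤ}

lemma unitApp_mem {φ : G ⟶ (restrict F).obj S} (hφ : φ ∈ homDeg K G ((restrict F).obj S) n)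
    (Y : A) : unitApp φ Y ∈ homDeg K (G.obj Y) (S.obj (F.obj Y)) n :=
  DGFunctor.app_mem hφ Y

lemma counitApp_mem {ψ : (restrict F).obj S ⟶ G} (hψ : ψ ∈ homDeg K ((restrict F).obj S) G n)
    (Y : A) : counitApp ψ Y ∈ homDeg K (S.obj (F.obj Y)) (G.obj Y) n :=
  DGFunctor.app_mem hψ Y

lemma isClosedZero_unitApp {φ : G ⟶ (restrict F).obj S} (hφ : IsClosedZero K φ) (Y : A) :
    IsClosedZero K (unitApp φ Y) :=
  DGFunctor.isClosedZero_app hφ Y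

lemma isClosedZero_counitApp {ψ : (restrict F).obj S ⟶ G} (hψ : IsClosedZero K ψ) (Y : A) :
    IsClosedZero K (counitApp ψ Y) :=
  DGFunctor.isClosedZero_app hψ Y

lemma unitApp_naturality {φ : G ⟶ (restrict F).obj S}
    (hφ : φ ∈ homDeg K G ((restrict F).obj S) n) {Y Y' : A} {a : Y ⟶ Y'}
    (ha : a ∈ homDeg K Y Y' m) :
    unitApp φ Y ≫ S.map (F.map a) = (n * m).negOnePow • (G.map a ≫ unitApp φ Y') :=
  DGFunctor.naturality_of_mem hφ ha

lemma counitApp_naturality {ψ : (restrict F).obj S ⟶ G}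
    (hψ : ψ ∈ homDeg K ((restrict F).obj S) G n) {Y Y' : A} {a : Y ⟶ Y'}
    (ha : a ∈ homDeg K Y Y' m) :
    counitApp ψ Y ≫ G.map a = (n * m).negOnePow • (S.map (F.map a) ≫ counitApp ψ Y') :=
  DGFunctor.naturality_of_mem hψ ha

end

/-! ### From the pointwise to the global universal property: left Kan extensions -/

namespace IsLeftKanExtension

variable {S : DgMod.{w, v} K C} {φ : G ⟶ (restrict F).obj S} (h : IsLeftKanExtension F G S φ)
include h

/-- This is the field `bijective`, phrased with `unitApp` so that the target of the unit is visibly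
`S.obj (F.obj Y)` and can be composed with `S.map f`. -/
lemma existsUnique (X : C) (B : DGModule.{w, v} K) (n : ℤ)
    (τ : ∀ Y : A, (F.obj Y ⟶ X) →ₗ[K] (G.obj Y ⟶ B))
    (h1 : ∀ (Y : A) (p : ℤ) (f : F.obj Y ⟶ X), f ∈ homDeg K (F.obj Y) X p →
      τ Y f ∈ homDeg K (G.obj Y) B (p + n))
    (h2 : ∀ (Y Y' : A) (a : Y ⟶ Y') (f : F.obj Y' ⟶ X), τ Y (F.map a ≫ f) = G.map a ≫ τ Y' f) :
    ∃! β : S.obj X ⟶ B, β ∈ homDeg K (S.obj X) B n ∧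
      ∀ (Y : A) (f : F.obj Y ⟶ X), τ Y f = unitApp φ Y ≫ S.map f ≫ β :=
  h.bijective X B n τ h1 h2

lemma unit_naturality {Y Y' : A} (a : Y ⟶ Y') :
    unitApp φ Y ≫ S.map (F.map a) = G.map a ≫ unitApp φ Y' :=
  DGFunctor.naturality_of_mem_zero h.closedZero.1 a

/-- Expresses that the images of the maps `S(f) ∘ φ_Y` generate `S X`. Both `β` and `β'` solve the
universal problem posed by `f ↦ β ∘ S(f) ∘ φ_Y`; linearity reduces the comparison to homogeneous
`f`. -/
lemma unique {X : C} {B : DGModule.{w, v} K} {n : ℤ} {β β' : S.obj X ⟶ B}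
    (hβ : β ∈ homDeg K (S.obj X) B n) (hβ' : β' ∈ homDeg K (S.obj X) B n)
    (heq : ∀ (Y : A) (p : ℤ) (f : F.obj Y ⟶ X), f ∈ homDeg K (F.obj Y) X p →
      unitApp φ Y ≫ S.map f ≫ β = unitApp φ Y ≫ S.map f ≫ β') : β = β' := by
  let τ : ∀ (β : S.obj X ⟶ B) (Y : A), (F.obj Y ⟶ X) →ₗ[K] (G.obj Y ⟶ B) := fun β Y =>
    Linear.leftComp K _ (unitApp φ Y) ∘ₗ Linear.rightComp K _ β ∘ₗ S.mapLinear _ _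
  have hτ : ∀ Y, τ β Y = τ β' Y := fun Y =>
    (DGCategory.dg (K := K) (F.obj Y) X).linearMap_ext fun p f hf => heq Y p f hf
  refine (h.existsUnique X B n (τ β) ?_ ?_).unique ⟨hβ, fun _ _ => rfl⟩
    ⟨hβ', fun Y f => by rw [hτ]; rfl⟩
  · intro Y p f hf
    exact IsClosedZero.comp_mem (isClosedZero_unitApp h.closedZero Y)
      (DGCategory.comp_mem (S.map_mem hf) hβ)
  · intro Y Y' a f
    change unitApp φ Y ≫ S.map (F.map a ≫ f) ≫ β = G.map a ≫ unitApp φ Y' ≫ S.map f ≫ β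
    rw [S.map_comp, Category.assoc, ← Category.assoc, h.unit_naturality, Category.assoc]

/-- The component at `X` of the factorisation of `θ` comes from the pointwise property with test
module `T X`. Naturality in `X` and uniqueness are then checked on the generators `S(f) ∘ φ_Y`. -/
lemma isUniversalFrom : IsUniversalFrom (restrict F) G S φ where
  closedZero := h.closedZero
  existsUnique T n θ hθ := by
    -- The family is `f ↦ (-1)^{n|f|} T(f) ∘ θ_Y`. The twist absorbs the sign `(-1)^{n|a|}` in the
    -- naturality of `θ`, whereas `τ` has to commute with `a` without sign.
    let τ : ∀ (X : C) (Y : A), (F.obj Y ⟶ X) →ₗ[K] (G.obj Y ⟶ T.obj X) := fun X Y =>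
      Linear.leftComp K _ (unitApp θ Y) ∘ₗ T.mapLinear _ _ ∘ₗ
        (DGCategory.dg (K := K) (F.obj Y) X).signPow n
    have hτ : ∀ {X : C} {Y : A} {p : ℤ} {f : F.obj Y ⟶ X}, f ∈ homDeg K (F.obj Y) X p →
        τ X Y f = (n * p).negOnePow • (unitApp θ Y ≫ T.map f) := fun {X Y p f} hf => by
      change unitApp θ Y ≫ T.map (DGStructure.signPow _ n f) = _
      rw [DGStructure.signPow_of_mem _ n hf, T.map_units_smul, Units.smul_def,
        Preadditive.comp_zsmul, ← Units.smul_def]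
    have hb : ∀ {X : C} {Y Y' : A} (a : Y ⟶ Y') (f : F.obj Y' ⟶ X),
        τ X Y (F.map a ≫ f) = G.map a ≫ τ X Y' f := fun {X Y Y'} a f => by
      induction a using (DGCategory.dg (K := K) Y Y').hom_induction with
      | mem m a ha =>
        induction f using (DGCategory.dg (K := K) (F.obj Y') X).hom_induction with
        | mem p f hf =>
          have hn : unitApp θ Y ≫ T.map (F.map a) = (n * m).negOnePow • (G.map a ≫ unitApp θ Y') :=
            unitApp_naturality hθ ha
          rw [hτ (DGCategory.comp_mem (F.map_mem ha) hf), hτ hf, T.map_comp, ← Category.assoc, hn]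
          simp only [Units.smul_def, Preadditive.comp_zsmul, Preadditive.zsmul_comp,
            Category.assoc]
          simp only [← Units.smul_def, smul_smul, ← Int.negOnePow_add]
          congr 1
          rw [Int.negOnePow_eq_iff]
          -- The exponents `n(m + p) + nm` and `np` differ by `2nm`.
          exact ⟨n * m, by ring⟩
        | zero => simp
        | add f f' h1 h2 => simp [h1, h2]
      | zero => rw [F.map_zero, G.map_zero]; simp
      | add a a' h1 h2 => simp [F.map_add, G.map_add, h1, h2]
    have hex := fun X => h.existsUnique X (T.obj X) n (τ X) (fun Y p f hf => by
        rw [hτ hf, add_comm]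
        exact DGStructure.units_smul_mem _ _
          (DGCategory.comp_mem (unitApp_mem hθ Y) (T.map_mem hf)))
      (fun Y Y' a f => hb a f)
    choose β hβ _ using hex
    have hβ' : ∀ {X : C} {Y : A} {p : ℤ} {f : F.obj Y ⟶ X}, f ∈ homDeg K (F.obj Y) X p →
        unitApp φ Y ≫ S.map f ≫ β X = (n * p).negOnePow • (unitApp θ Y ≫ T.map f) :=
      fun {X Y p f} hf => by rw [← hτ hf, (hβ X).2]
    have hmem : β ∈ DGFunctor.natGr S T n := by
      refine ⟨fun X => (hβ X).1, fun m X X' g hg => ?_⟩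
      have h1 : β X ≫ T.map g ∈ homDeg K (S.obj X) (T.obj X') (n + m) :=
        DGCategory.comp_mem (hβ X).1 (T.map_mem hg)
      have h2 : S.map g ≫ β X' ∈ homDeg K (S.obj X) (T.obj X') (n + m) := by
        rw [add_comm]
        exact DGCategory.comp_mem (S.map_mem hg) (hβ X').1
      refine h.unique h1 (DGStructure.units_smul_mem _ _ h2) fun Y p f hf => ?_
      have e1 := congrArg (· ≫ T.map g) (hβ' hf)
      have e2 := hβ' (DGCategory.comp_mem hf hg)
      simp only [S.map_comp, T.map_comp, Category.assoc, Units.smul_def, Preadditive.comp_zsmul,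
        Preadditive.zsmul_comp] at e1 e2 ⊢
      rw [e1, e2]
      simp only [← Units.smul_def, smul_smul, ← Int.negOnePow_add]
      congr 1
      rw [Int.negOnePow_eq_iff]
      exact ⟨-(n * m), by ring⟩
    refine ⟨⟨β, Submodule.mem_iSup_of_mem n hmem⟩, ⟨hmem, ?_⟩, ?_⟩
    · refine unitApp_ext fun Y => ?_
      -- The identity of `F Y` has degree zero, so the twist disappears and the factorisation of `θ`
      -- through `φ` is recovered.
      have := hβ' (DGCategory.id_mem (K := K) (F.obj Y))
      rw [mul_zero, Int.negOnePow_zero, one_smul, S.map_id, T.map_id, Category.id_comp] at this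
      rw [Category.comp_id] at this
      exact this
    · rintro g ⟨hg, hgθ⟩
      refine DGFunctor.hom_ext fun X => ?_
      refine h.unique (DGFunctor.app_mem hg X) (hβ X).1 fun Y p f hf => ?_
      rw [hβ' hf]
      -- Naturality moves `g` past `S(f)`, so `g` is determined on generators by `φ ≫ F_*(g) = θ`.
      have e1 : S.map f ≫ g.app X = (n * p).negOnePow • (g.app (F.obj Y) ≫ T.map f) := by
        rw [DGFunctor.naturality_of_mem hg hf, smul_smul, Int.units_mul_self, one_smul]
      have e2 : unitApp φ Y ≫ g.app (F.obj Y) = unitApp θ Y := by rw [← hgθ]; rfl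
      rw [e1, ← e2, Units.smul_def, Preadditive.comp_zsmul, Category.assoc, ← Units.smul_def]

/-- The unit of the left Kan extension along a fully faithful dg-functor is invertible. -/
lemma isIso_unit (hF : F.IsFullyFaithful) : IsIso φ := by
  -- The candidate inverse at `X` is the map `S(F X) → G X` classified by `F(f) ↦ G(f)`. This family
  -- is well defined because every morphism `F Y ⟶ F X` is `F(f)` for a unique `f`.
  have hex := fun X : A => h.existsUnique (F.obj X) (G.obj X) 0
    (fun Y => G.mapLinear Y X ∘ₗ (hF.mapEquiv Y X).symm.toLinearMap)
    (fun Y p f hf => by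
      rw [add_zero]
      exact G.map_mem (hF.mapEquiv_symm_mem hf))
    (fun Y Y' a f => by
      obtain ⟨f, rfl⟩ := (hF.mapEquiv Y' X).surjective f
      have : F.map a ≫ hF.mapEquiv Y' X f = hF.mapEquiv Y X (a ≫ f) := (F.map_comp a f).symm
      rw [this]
      change G.map ((hF.mapEquiv Y X).symm _) = G.map a ≫ G.map ((hF.mapEquiv Y' X).symm _)
      rw [LinearEquiv.symm_apply_apply, LinearEquiv.symm_apply_apply, G.map_comp])
  choose β hβ _ using hex
  have hβ' : ∀ {X Y : A} (f : Y ⟶ X), unitApp φ Y ≫ S.map (F.map f) ≫ β X = G.map f :=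
    fun {X Y} f => by
      rw [← (hβ X).2 Y (F.map f), ← hF.mapEquiv_apply]
      change G.map ((hF.mapEquiv Y X).symm _) = _
      rw [LinearEquiv.symm_apply_apply]
  refine DGFunctor.isIso_of_app h.closedZero.1 β (fun X => (hβ X).1) (fun X => ?_) (fun X => ?_)
  · have := hβ' (𝟙 X)
    rw [F.map_id, S.map_id, G.map_id, Category.id_comp] at this
    exact this
  -- On the generator indexed by `F(f)` both sides become `φ_X ∘ G(f) = S(F f) ∘ φ_Y`, by naturality
  -- of the unit.
  · refine h.unique (n := 0) ?_ (DGCategory.id_mem _) fun Y p f _ => ?_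
    · exact IsClosedZero.mem_comp (hβ X).1 (isClosedZero_unitApp h.closedZero X)
    · obtain ⟨f, rfl⟩ := (hF.mapEquiv Y X).surjective f
      have e := congrArg (· ≫ unitApp φ X) (hβ' f)
      simp only [Category.assoc] at e
      change unitApp φ Y ≫ S.map (hF.mapEquiv Y X f) ≫ β X ≫ unitApp φ X =
        unitApp φ Y ≫ S.map (hF.mapEquiv Y X f) ≫ 𝟙 (S.obj (F.obj X))
      rw [hF.mapEquiv_apply, e, ← h.unit_naturality]
      rw [Category.comp_id]

end IsLeftKanExtension

/-! ### From the pointwise to the global universal property: right Kan extensions -/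

namespace IsRightKanExtension

variable {T : DgMod.{w, v} K C} {ψ : (restrict F).obj T ⟶ G} (h : IsRightKanExtension F G T ψ)
include h

lemma existsUnique (X : C) (B : DGModule.{w, v} K) (n : ℤ)
    (τ : ∀ Y : A, (X ⟶ F.obj Y) →ₗ[K] (B ⟶ G.obj Y))
    (h1 : ∀ (Y : A) (p : ℤ) (f : X ⟶ F.obj Y), f ∈ homDeg K X (F.obj Y) p →
      τ Y f ∈ homDeg K B (G.obj Y) (p + n))
    (h2 : ∀ (m : ℤ) (Y Y' : A) (a : Y ⟶ Y') (f : X ⟶ F.obj Y), a ∈ homDeg K Y Y' m →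
      τ Y f ≫ G.map a = (n * m).negOnePow • τ Y' (f ≫ F.map a)) :
    ∃! β : B ⟶ T.obj X, β ∈ homDeg K B (T.obj X) n ∧
      ∀ (Y : A) (p : ℤ) (f : X ⟶ F.obj Y), f ∈ homDeg K X (F.obj Y) p →
        τ Y f = (n * p).negOnePow • (β ≫ T.map f ≫ counitApp ψ Y) :=
  h.bijective X B n τ h1 h2

lemma counit_naturality {Y Y' : A} (a : Y ⟶ Y') :
    counitApp ψ Y ≫ G.map a = T.map (F.map a) ≫ counitApp ψ Y' :=
  DGFunctor.naturality_of_mem_zero h.closedZero.1 a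

/-- The evaluations `ψ_Y ∘ T(f)` are jointly monic. The sign `(-1)^{n|f|}` in the definition of a
right Kan extension is invertible, so the hypothesis can be stated without it. -/
lemma unique {X : C} {B : DGModule.{w, v} K} {n : ℤ} {β β' : B ⟶ T.obj X}
    (hβ : β ∈ homDeg K B (T.obj X) n) (hβ' : β' ∈ homDeg K B (T.obj X) n)
    (heq : ∀ (Y : A) (p : ℤ) (f : X ⟶ F.obj Y), f ∈ homDeg K X (F.obj Y) p →
      β ≫ T.map f ≫ counitApp ψ Y = β' ≫ T.map f ≫ counitApp ψ Y) : β = β' := by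
  -- The family classified by `β`, with its sign; `signPow` keeps it linear in `f`.
  let τ : ∀ Y : A, (X ⟶ F.obj Y) →ₗ[K] (B ⟶ G.obj Y) := fun Y =>
    Linear.leftComp K _ β ∘ₗ Linear.rightComp K _ (counitApp ψ Y) ∘ₗ T.mapLinear _ _ ∘ₗ
      (DGCategory.dg (K := K) X (F.obj Y)).signPow n
  have hτ : ∀ {Y : A} {p : ℤ} {f : X ⟶ F.obj Y}, f ∈ homDeg K X (F.obj Y) p →
      τ Y f = (n * p).negOnePow • (β ≫ T.map f ≫ counitApp ψ Y) := fun {Y p f} hf => by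
    change β ≫ T.map (DGStructure.signPow _ n f) ≫ counitApp ψ Y = _
    rw [DGStructure.signPow_of_mem _ n hf, T.map_units_smul]
    simp only [Units.smul_def, Preadditive.comp_zsmul, Preadditive.zsmul_comp]
  refine (h.existsUnique X B n τ ?_ ?_).unique ⟨hβ, fun _ _ _ hf => hτ hf⟩
    ⟨hβ', fun Y p f hf => by rw [hτ hf, heq Y p f hf]⟩
  · intro Y p f hf
    rw [hτ hf, add_comm]
    exact DGStructure.units_smul_mem _ _ (DGCategory.comp_mem hβ
      (IsClosedZero.mem_comp (T.map_mem hf) (isClosedZero_counitApp h.closedZero Y)))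
  · intro m Y Y' a f ha
    induction f using (DGCategory.dg (K := K) X (F.obj Y)).hom_induction with
    | mem p f hf =>
      rw [hτ hf, hτ (DGCategory.comp_mem hf (F.map_mem ha)), T.map_comp, smul_smul]
      simp only [Units.smul_def, Preadditive.zsmul_comp, Category.assoc]
      have e := h.counit_naturality a
      rw [e]
      simp only [← Units.smul_def]
      congr 1
      rw [← Int.negOnePow_add, Int.negOnePow_eq_iff]
      exact ⟨-(n * m), by ring⟩
    | zero => simp
    | add f f' h1 h2 => simp [h1, h2]

/-- Dual to `IsLeftKanExtension.isUniversalFrom`, except that the family `f ↦ θ_Y ∘ T'(f)` needs no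
twist: the signed compatibility demanded of `τ` is precisely the naturality of `θ`. -/
lemma isUniversalTo : IsUniversalTo (restrict F) G T ψ where
  closedZero := h.closedZero
  existsUnique T' n θ hθ := by
    let τ : ∀ (X : C) (Y : A), (X ⟶ F.obj Y) →ₗ[K] (T'.obj X ⟶ G.obj Y) := fun X Y =>
      Linear.rightComp K _ (counitApp θ Y) ∘ₗ T'.mapLinear _ _
    have hex := fun X => h.existsUnique X (T'.obj X) n (τ X)
      (fun Y p f hf => DGCategory.comp_mem (T'.map_mem hf) (counitApp_mem hθ Y))
      (fun m Y Y' a f ha => by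
        have hn : counitApp θ Y ≫ G.map a = (n * m).negOnePow • (T'.map (F.map a) ≫ counitApp θ Y') :=
          counitApp_naturality hθ ha
        change (T'.map f ≫ counitApp θ Y) ≫ G.map a = _ • (T'.map (f ≫ F.map a) ≫ counitApp θ Y')
        rw [Category.assoc, hn, T'.map_comp]
        simp only [Units.smul_def, Preadditive.comp_zsmul, Category.assoc])
    choose β hβ _ using hex
    have hβ' : ∀ {X : C} {Y : A} {p : ℤ} {f : X ⟶ F.obj Y}, f ∈ homDeg K X (F.obj Y) p →
        β X ≫ T.map f ≫ counitApp ψ Y = (n * p).negOnePow • (T'.map f ≫ counitApp θ Y) :=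
      fun {X Y p f} hf => by
        have e : T'.map f ≫ counitApp θ Y = (n * p).negOnePow • (β X ≫ T.map f ≫ counitApp ψ Y) :=
          (hβ X).2 Y p f hf
        rw [e, smul_smul, Int.units_mul_self, one_smul]
    have hmem : β ∈ DGFunctor.natGr T' T n := by
      refine ⟨fun X => (hβ X).1, fun m X X' g hg => ?_⟩
      have h1 : β X ≫ T.map g ∈ homDeg K (T'.obj X) (T.obj X') (n + m) :=
        DGCategory.comp_mem (hβ X).1 (T.map_mem hg)
      have h2 : T'.map g ≫ β X' ∈ homDeg K (T'.obj X) (T.obj X') (n + m) := by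
        rw [add_comm]
        exact DGCategory.comp_mem (T'.map_mem hg) (hβ X').1
      refine h.unique h1 (DGStructure.units_smul_mem _ _ h2) fun Y p f hf => ?_
      have e1 := congrArg (T'.map g ≫ ·) (hβ' hf)
      have e2 := hβ' (DGCategory.comp_mem hg hf)
      simp only [T.map_comp, T'.map_comp, Category.assoc, Units.smul_def, Preadditive.comp_zsmul,
        Preadditive.zsmul_comp] at e1 e2 ⊢
      rw [e1, e2]
      simp only [← Units.smul_def, smul_smul, ← Int.negOnePow_add]
      congr 2
      ring
    refine ⟨⟨β, Submodule.mem_iSup_of_mem n hmem⟩, ⟨hmem, ?_⟩, ?_⟩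
    · refine counitApp_ext fun Y => ?_
      have := hβ' (DGCategory.id_mem (K := K) (F.obj Y))
      rw [mul_zero, Int.negOnePow_zero, one_smul, T.map_id, T'.map_id, Category.id_comp] at this
      rw [Category.id_comp] at this
      exact this
    · rintro g ⟨hg, hgθ⟩
      refine DGFunctor.hom_ext fun X => ?_
      refine h.unique (DGFunctor.app_mem hg X) (hβ X).1 fun Y p f hf => ?_
      rw [hβ' hf, ← Category.assoc, DGFunctor.naturality_of_mem hg hf]
      have e2 : g.app (F.obj Y) ≫ counitApp ψ Y = counitApp θ Y := by rw [← hgθ]; rfl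
      rw [← e2, Units.smul_def, Preadditive.zsmul_comp, Category.assoc, ← Units.smul_def]

/-- The counit of the right Kan extension along a fully faithful dg-functor is invertible. -/
lemma isIso_counit (hF : F.IsFullyFaithful) : IsIso ψ := by
  -- The candidate inverse `G X → T(F X)` is classified by `F(f) ↦ G(f)`; its degree is zero, so all
  -- signs in the universal property are trivial.
  have hex := fun X : A => h.existsUnique (F.obj X) (G.obj X) 0
    (fun Y => G.mapLinear X Y ∘ₗ (hF.mapEquiv X Y).symm.toLinearMap)
    (fun Y p f hf => by
      rw [add_zero]
      exact G.map_mem (hF.mapEquiv_symm_mem hf))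
    (fun m Y Y' a f _ => by
      obtain ⟨f, rfl⟩ := (hF.mapEquiv X Y).surjective f
      have : hF.mapEquiv X Y f ≫ F.map a = hF.mapEquiv X Y' (f ≫ a) := (F.map_comp f a).symm
      rw [this, zero_mul, Int.negOnePow_zero, one_smul]
      change G.map ((hF.mapEquiv X Y).symm _) ≫ G.map a = G.map ((hF.mapEquiv X Y').symm _)
      rw [LinearEquiv.symm_apply_apply, LinearEquiv.symm_apply_apply, G.map_comp])
  choose β hβ _ using hex
  have hβ' : ∀ {X Y : A} {p : ℤ} {f : X ⟶ Y}, f ∈ homDeg K X Y p →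
      β X ≫ T.map (F.map f) ≫ counitApp ψ Y = G.map f := fun {X Y p f} hf => by
    have e := (hβ X).2 Y p (F.map f) (F.map_mem hf)
    rw [zero_mul, Int.negOnePow_zero, one_smul] at e
    rw [← e, ← hF.mapEquiv_apply]
    change G.map ((hF.mapEquiv X Y).symm _) = _
    rw [LinearEquiv.symm_apply_apply]
  refine DGFunctor.isIso_of_app h.closedZero.1 β (fun X => (hβ X).1) (fun X => ?_) (fun X => ?_)
  · refine h.unique (n := 0) ?_ (DGCategory.id_mem _) fun Y p f hf => ?_
    · exact IsClosedZero.comp_mem (isClosedZero_counitApp h.closedZero X) (hβ X).1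
    · have hf' := hF.mapEquiv_symm_mem hf
      obtain ⟨f, rfl⟩ := (hF.mapEquiv X Y).surjective f
      rw [LinearEquiv.symm_apply_apply] at hf'
      change (counitApp ψ X ≫ β X) ≫ T.map (hF.mapEquiv X Y f) ≫ counitApp ψ Y =
        𝟙 (T.obj (F.obj X)) ≫ T.map (hF.mapEquiv X Y f) ≫ counitApp ψ Y
      rw [hF.mapEquiv_apply, Category.assoc, hβ' hf', h.counit_naturality]
      rw [Category.id_comp]
  · have := hβ' (DGCategory.id_mem (K := K) X)
    rw [F.map_id, T.map_id, G.map_id, Category.id_comp] at this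
    exact this

end IsRightKanExtension

end KanExtensions

/-! ### The degree involution and the Leibniz rule for inhomogeneous morphisms -/

section Signs

variable {K : Type w} [CommRing K]
  {C : Type u₁} [Category.{v₁} C] [Preadditive C] [Linear K C] [DGCategory K C]

variable (K) in
/-- The degree involution on a module of morphisms. -/
abbrev homSign {X Y : C} (f : X ⟶ Y) : X ⟶ Y := (DGCategory.dg (K := K) X Y).sign f

lemma homSign_comp {X Y Z : C} (f : X ⟶ Y) (g : Y ⟶ Z) :
    homSign K (f ≫ g) = homSign K f ≫ homSign K g := by
  induction f using (DGCategory.dg (K := K) X Y).hom_induction with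
  | mem m f hf =>
    induction g using (DGCategory.dg (K := K) Y Z).hom_induction with
    | mem n g hg =>
      rw [homSign, homSign, homSign, DGStructure.sign_of_mem _ hf, DGStructure.sign_of_mem _ hg,
        DGStructure.sign_of_mem _ (DGCategory.comp_mem hf hg), Int.negOnePow_add]
      simp only [Units.smul_def, Preadditive.comp_zsmul, Preadditive.zsmul_comp]
      simp only [← Units.smul_def, smul_smul, mul_comm]
    | zero => simp
    | add g g' h1 h2 => simp only [homSign] at h1 h2; simp [h1, h2]
  | zero => simp
  | add f f' h1 h2 => simp only [homSign] at h1 h2; simp [h1, h2]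

/-- The Leibniz rule for arbitrary morphisms. -/
lemma homD_comp {X Y Z : C} (f : X ⟶ Y) (g : Y ⟶ Z) :
    homD K (f ≫ g) = f ≫ homD K g + homD K f ≫ homSign K g := by
  induction g using (DGCategory.dg (K := K) Y Z).hom_induction with
  | mem n g hg =>
    rw [homD, DGCategory.d_comp f hg, homSign, DGStructure.sign_of_mem _ hg]
    simp only [Units.smul_def, Preadditive.comp_zsmul]
  | zero => simp
  | add g g' h1 h2 =>
    simp only [homSign, homD] at h1 h2
    simp only [homSign, homD, Preadditive.comp_add, map_add, h1, h2]
    abel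

lemma homSign_id (X : C) : homSign K (𝟙 X) = 𝟙 X := by
  rw [homSign, DGStructure.sign_of_mem _ (DGCategory.id_mem X), Int.negOnePow_zero, one_smul]

/-- The Leibniz rule for `𝟙 = 𝟙 ≫ 𝟙` reads `d 𝟙 = d 𝟙 + d 𝟙`. -/
lemma homD_id (X : C) : homD K (𝟙 X) = 0 := by
  have h := homD_comp (K := K) (𝟙 X) (𝟙 X)
  rw [homSign_id, Category.id_comp, Category.id_comp, Category.comp_id] at h
  simpa using h

variable {D : Type u₂} [Category.{v₂} D] [Preadditive D] [Linear K D] [DGCategory K D]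

lemma DGFunctor.map_homSign (F : DGFunctor K C D) {X Y : C} (f : X ⟶ Y) :
    F.map (homSign K f) = homSign K (F.map f) := by
  refine LinearMap.congr_fun ((DGCategory.dg (K := K) X Y).linearMap_ext
    (f := F.mapLinear X Y ∘ₗ (DGCategory.dg (K := K) X Y).sign)
    (g := (DGCategory.dg (K := K) _ _).sign ∘ₗ F.mapLinear X Y) fun m f hf => ?_) f
  change F.map (homSign K f) = homSign K (F.map f)
  rw [homSign, homSign, DGStructure.sign_of_mem _ hf, DGStructure.sign_of_mem _ (F.map_mem hf),
    F.map_units_smul]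

end Signs

namespace DGModule

variable {K : Type w} [CommRing K] {M N : DGModule.{w, v} K}

/-- The underlying linear map of a morphism, as a linear operation. -/
def linLinear (M N : DGModule.{w, v} K) : (M ⟶ N) →ₗ[K] (M.carrier →ₗ[K] N.carrier) where
  toFun f := f.lin
  map_add' _ _ := rfl
  map_smul' _ _ := rfl

lemma add_lin (f g : M ⟶ N) : (f + g).lin = f.lin + g.lin := rfl

lemma smul_lin (c : K) (f : M ⟶ N) : (c • f).lin = c • f.lin := rfl

lemma zero_lin : (0 : M ⟶ N).lin = 0 := rfl

lemma units_smul_lin (ε : ℤˣ) (f : M ⟶ N) : (ε • f).lin = ε • f.lin :=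
  map_zsmul_unit (linLinear M N) ε f

/-- A linear map of degree `n` as a morphism of dg-modules. -/
def homOfDeg {n : ℤ} (f : M.carrier →ₗ[K] N.carrier)
    (hf : ∀ i, ∀ x ∈ M.dg.gr i, f x ∈ N.dg.gr (i + n)) : M ⟶ N :=
  ⟨f, Submodule.mem_iSup_of_mem n hf⟩

lemma isClosedZero_homOfDeg (f : M.carrier →ₗ[K] N.carrier)
    (hf : ∀ i, ∀ x ∈ M.dg.gr i, f x ∈ N.dg.gr (i + 0)) (hd : ∀ x, N.dg.d (f x) = f (M.dg.d x)) :
    IsClosedZero K (homOfDeg f hf) := by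
  have hm : homOfDeg f hf ∈ homDeg K M N 0 := hf
  refine ⟨hm, DGModule.hom_ext ?_⟩
  rw [homD_lin hm, Int.negOnePow_zero, one_smul]
  ext x
  simpa [homOfDeg, sub_eq_zero, zero_lin] using hd x

lemma d_lin {n : ℤ} {f : M ⟶ N} (hf : f ∈ homDeg K M N n) (x : M.carrier) :
    N.dg.d (f.lin x) = (homD K f).lin x + n.negOnePow • f.lin (M.dg.d x) := by
  rw [homD_lin hf]
  simp

end DGModule

/-- A closed dg-natural transformation of degree zero from a family of closed morphisms of
degree zero that is natural without signs. -/
lemma DGFunctor.exists_isClosedZero {K : Type w} [CommRing K]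
    {C : Type u₁} [Category.{v₁} C] [Preadditive C] [Linear K C] [DGCategory K C]
    {D : Type u₂} [Category.{v₂} D] [Preadditive D] [Linear K D] [DGCategory K D]
    {F G : DGFunctor K C D} (η : ∀ X, F.obj X ⟶ G.obj X) (hη : ∀ X, IsClosedZero K (η X))
    (hn : ∀ {X Y : C} (f : X ⟶ Y), η X ≫ G.map f = F.map f ≫ η Y) :
    ∃ θ : F ⟶ G, IsClosedZero K θ ∧ θ.app = η := by
  have hmem : η ∈ DGFunctor.natGr F G 0 := ⟨fun X => (hη X).1, fun m X Y f _ => by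
    rw [zero_mul, Int.negOnePow_zero, one_smul, hn]⟩
  exact ⟨⟨η, Submodule.mem_iSup_of_mem 0 hmem⟩, ⟨hmem, DGFunctor.hom_ext fun X => (hη X).2⟩, rfl⟩

/-! ### Construction of right Kan extensions -/

section Ran

variable {K : Type u} [CommRing K]
  {A : Type u} [Category.{u} A] [Preadditive A] [Linear K A] [DGCategory K A]
  {C : Type u₂} [Category.{u} C] [Preadditive C] [Linear K C] [DGCategory K C]
  (F : DGFunctor K A C) (G : DgMod.{u, u} K A)

/-- Families of linear maps `C(X, F Y) → G Y`. -/
abbrev RanFamily (X : C) : Type u := ∀ Y : A, (X ⟶ F.obj Y) →ₗ[K] (G.obj Y).carrier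

/-- The families of degree `n` that commute with the action of `A`. With the convention that the
family acts from the right on its argument, no signs appear. -/
def ranGr (X : C) (n : ℤ) : Submodule K (RanFamily F G X) where
  carrier := {t | (∀ (Y : A) (p : ℤ) (f : X ⟶ F.obj Y), f ∈ homDeg K X (F.obj Y) p →
      t Y f ∈ (G.obj Y).dg.gr (p + n)) ∧
    ∀ (Y Y' : A) (a : Y ⟶ Y') (f : X ⟶ F.obj Y), (G.map a).lin (t Y f) = t Y' (f ≫ F.map a)}
  zero_mem' := ⟨fun _ _ _ _ => Submodule.zero_mem _, fun _ _ _ _ => by simp⟩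
  add_mem' h1 h2 := ⟨fun Y p f hf => Submodule.add_mem _ (h1.1 Y p f hf) (h2.1 Y p f hf),
    fun Y Y' a f => by simp [h1.2 Y Y' a f, h2.2 Y Y' a f]⟩
  smul_mem' c t h := ⟨fun Y p f hf => Submodule.smul_mem _ c (h.1 Y p f hf),
    fun Y Y' a f => by simp [h.2 Y Y' a f]⟩

/-- At `f` of degree `p`, the summand of degree `n` takes its value in degree `p + n`, so projecting
there isolates it from a vanishing sum. -/
lemma iSupIndep_ranGr (X : C) : iSupIndep (ranGr F G X) := by
  refine (iSupIndep_iff_finsetSum_eq_zero_imp_eq_zero _).2 fun s t ht h n hn => ?_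
  refine funext fun Y => (DGCategory.dg (K := K) X (F.obj Y)).linearMap_ext fun p f hf => ?_
  have h0 : (G.obj Y).dg.proj (p + n) ((∑ m ∈ s, t m) Y f) = t n Y f := by
    rw [Finset.sum_apply, LinearMap.sum_apply, map_sum, Finset.sum_eq_single_of_mem n hn,
      (G.obj Y).dg.proj_of_mem ((ht n hn).1 Y p f hf)]
    intro m hm hne
    exact (G.obj Y).dg.proj_of_mem_ne (by omega) ((ht m hm).1 Y p f hf)
  rw [← h0, h]
  simp

/-- The differential `t ↦ (d ∘ t - t ∘ d) ∘ sign`. -/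
def ranDiff (X : C) : RanFamily F G X →ₗ[K] RanFamily F G X :=
  LinearMap.pi fun Y =>
    LinearMap.lcomp K (G.obj Y).carrier (DGCategory.dg (K := K) X (F.obj Y)).sign ∘ₗ
      (LinearMap.llcomp K (X ⟶ F.obj Y) (G.obj Y).carrier (G.obj Y).carrier (G.obj Y).dg.d -
        LinearMap.lcomp K (G.obj Y).carrier (DGCategory.dg (K := K) X (F.obj Y)).d) ∘ₗ
      LinearMap.proj Y

/-- The formula is the usual `d τ = d ∘ τ - (-1)^{|τ|} τ ∘ d` rewritten for `t(f) = (-1)^{|τ||f|}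
τ(f)`: all signs combine to `(-1)^{|f|}`, which does not depend on the degree of `t`. -/
lemma ranDiff_apply (X : C) (t : RanFamily F G X) (Y : A) (f : X ⟶ F.obj Y) :
    ranDiff F G X t Y f =
      (G.obj Y).dg.d (t Y (homSign K f)) - t Y (homD K (homSign K f)) := rfl

lemma ranDiff_mem {X : C} {n : ℤ} {t : RanFamily F G X} (ht : t ∈ ranGr F G X n) :
    ranDiff F G X t ∈ ranGr F G X (n + 1) := by
  refine ⟨fun Y p f hf => ?_, fun Y Y' a f => ?_⟩
  · have hs := DGStructure.sign_mem _ hf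
    rw [ranDiff_apply]
    refine Submodule.sub_mem _ ?_ ?_
    · have := (G.obj Y).dg.d_mem (ht.1 Y p _ hs)
      rwa [add_assoc] at this
    · have := ht.1 Y _ _ (DGStructure.d_mem _ hs)
      rwa [add_assoc, add_comm 1 n] at this
  · induction a using (DGCategory.dg (K := K) Y Y').hom_induction with
    | mem m a ha =>
      -- Expanding `d` of `G(a)(t(f))` by the Leibniz rule in `G`, and `d (f ≫ F a)` by the one in
      -- `C`, produces the same term in `d a`; the two cancel in `d ∘ t - t ∘ d`.
      have e := DGModule.d_lin (G.map_mem ha) (t Y (homSign K f))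
      rw [← G.map_d, ht.2, ht.2, F.map_d] at e
      have hs : homSign K (F.map a) = m.negOnePow • F.map a :=
        DGStructure.sign_of_mem _ (F.map_mem ha)
      have hs' : homSign K (homSign K (F.map a)) = F.map a := DGStructure.sign_sign _ _
      have hsd : homD K (homSign K (F.map a)) = m.negOnePow • homD K (F.map a) := by
        rw [hs, homD, map_zsmul_unit]
      rw [ranDiff_apply, ranDiff_apply, map_sub, homSign_comp, homD_comp, hs', hsd, hs, map_add,
        ht.2]
      have e1 : ∀ (g : X ⟶ F.obj Y) (b : F.obj Y ⟶ F.obj Y'),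
          t Y' (g ≫ (m.negOnePow • b)) = m.negOnePow • t Y' (g ≫ b) := fun g b => by
        rw [← map_zsmul_unit]
        simp only [Units.smul_def, Preadditive.comp_zsmul]
      rw [e1, e1, map_zsmul_unit, e, smul_add, smul_smul, Int.units_mul_self, one_smul]
      abel
    | zero => rw [G.map_zero, F.map_zero]; simp [DGModule.zero_lin]
    | add a a' h1 h2 => simp [G.map_add, F.map_add, DGModule.add_lin, h1, h2]

lemma ranDiff_ranDiff {X : C} (t : RanFamily F G X) : ranDiff F G X (ranDiff F G X t) = 0 := by
  refine funext fun Y => LinearMap.ext fun f => ?_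
  simp only [ranDiff_apply]
  simp [(G.obj Y).dg.d_d, DGStructure.d_d, DGStructure.sign_sign, DGStructure.sign_d]

/-- The value at `X` of the right Kan extension of `G` along `F`. -/
def ranObj (X : C) : DGModule.{u, u} K where
  carrier := ↥(⨆ n, ranGr F G X n)
  dg := DGStructure.ofIndep (ranGr F G X) (iSupIndep_ranGr F G X) (ranDiff F G X)
    (fun _ _ h => ranDiff_mem F G h) (fun t _ => ranDiff_ranDiff F G t)

/-- The underlying family of an element of the right Kan extension. -/
def ranFamily (X : C) : (ranObj F G X).carrier →ₗ[K] RanFamily F G X :=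
  (⨆ n, ranGr F G X n).subtype

lemma ranFamily_injective (X : C) : Function.Injective (ranFamily F G X) :=
  Subtype.val_injective

lemma ranFamily_d {X : C} (t : (ranObj F G X).carrier) :
    ranFamily F G X ((ranObj F G X).dg.d t) = ranDiff F G X (ranFamily F G X t) := rfl

lemma ranFamily_naturality {X : C} (t : (ranObj F G X).carrier) {Y Y' : A} (a : Y ⟶ Y')
    (f : X ⟶ F.obj Y) :
    (G.map a).lin (ranFamily F G X t Y f) = ranFamily F G X t Y' (f ≫ F.map a) := by
  induction t using (ranObj F G X).dg.hom_induction with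
  | mem n t ht => exact ht.2 Y Y' a f
  | zero => simp
  | add t t' h1 h2 => simp [h1, h2]

/-- A linear map with values in homogeneous families, as a linear map to the right Kan
extension. -/
def ranLift {B : DGModule.{u, u} K} {X : C} (b : B.carrier →ₗ[K] RanFamily F G X)
    (hb : ∀ i, ∀ x ∈ B.dg.gr i, b x ∈ ⨆ n, ranGr F G X n) :
    B.carrier →ₗ[K] (ranObj F G X).carrier :=
  b.codRestrict (⨆ n, ranGr F G X n) fun x => by
    induction x using B.dg.hom_induction with
    | mem i x hx => exact hb i x hx
    | zero => rw [map_zero]; exact Submodule.zero_mem _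
    | add x y h1 h2 => rw [map_add]; exact Submodule.add_mem _ h1 h2

/-- Precomposition of families with a morphism. -/
def ranPre {X X' : C} (f : X ⟶ X') : RanFamily F G X →ₗ[K] RanFamily F G X' :=
  LinearMap.pi fun Y =>
    LinearMap.lcomp K (G.obj Y).carrier (Linear.leftComp K (F.obj Y) f) ∘ₗ LinearMap.proj Y

lemma ranPre_apply {X X' : C} (f : X ⟶ X') (t : RanFamily F G X) (Y : A) (g : X' ⟶ F.obj Y) :
    ranPre F G f t Y g = t Y (f ≫ g) := rfl

lemma ranPre_mem {X X' : C} {m n : ℤ} {f : X ⟶ X'} (hf : f ∈ homDeg K X X' m)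
    {t : RanFamily F G X} (ht : t ∈ ranGr F G X n) : ranPre F G f t ∈ ranGr F G X' (n + m) := by
  refine ⟨fun Y p g hg => ?_, fun Y Y' a g => ?_⟩
  · have := ht.1 Y _ _ (DGCategory.comp_mem hf hg)
    rwa [show m + p + n = p + (n + m) by ring] at this
  · rw [ranPre_apply, ranPre_apply, ht.2, Category.assoc]

/-- The action of a morphism on the right Kan extension, as a linear map. -/
def ranMapLin {X X' : C} (f : X ⟶ X') :
    (ranObj F G X).carrier →ₗ[K] (ranObj F G X').carrier :=
  ranLift F G (ranPre F G f ∘ₗ ranFamily F G X) fun i t ht => by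
    induction f using (DGCategory.dg (K := K) X X').hom_induction with
    | mem m f hf => exact Submodule.mem_iSup_of_mem _ (ranPre_mem F G hf ht)
    | zero =>
      have : (ranPre F G (0 : X ⟶ X') ∘ₗ ranFamily F G X) t = 0 := by
        refine funext fun Y => LinearMap.ext fun g => ?_
        simp [ranPre_apply]
      rw [this]
      exact Submodule.zero_mem _
    | add f f' h1 h2 =>
      have : (ranPre F G (f + f') ∘ₗ ranFamily F G X) t =
          (ranPre F G f ∘ₗ ranFamily F G X) t + (ranPre F G f' ∘ₗ ranFamily F G X) t := by
        refine funext fun Y => LinearMap.ext fun g => ?_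
        simp [ranPre_apply]
      rw [this]
      exact Submodule.add_mem _ h1 h2

lemma ranFamily_ranMapLin {X X' : C} (f : X ⟶ X') (t : (ranObj F G X).carrier) (Y : A)
    (g : X' ⟶ F.obj Y) :
    ranFamily F G X' (ranMapLin F G f t) Y g = ranFamily F G X t Y (f ≫ g) := rfl

lemma ran_ext {X : C} {t t' : (ranObj F G X).carrier}
    (h : ∀ (Y : A) (f : X ⟶ F.obj Y), ranFamily F G X t Y f = ranFamily F G X t' Y f) : t = t' :=
  ranFamily_injective F G X (funext fun Y => LinearMap.ext fun f => h Y f)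

lemma ranMapLin_zero (X X' : C) : ranMapLin F G (0 : X ⟶ X') = 0 :=
  LinearMap.ext fun t => ran_ext F G fun Y g => by simp [ranFamily_ranMapLin]

lemma ranMapLin_add {X X' : C} (f f' : X ⟶ X') :
    ranMapLin F G (f + f') = ranMapLin F G f + ranMapLin F G f' :=
  LinearMap.ext fun t => ran_ext F G fun Y g => by simp [ranFamily_ranMapLin]

lemma ranMapLin_mem {X X' : C} (f : X ⟶ X') :
    ranMapLin F G f ∈ DGModule.homTotal (ranObj F G X) (ranObj F G X') := by
  induction f using (DGCategory.dg (K := K) X X').hom_induction with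
  | mem m f hf => exact Submodule.mem_iSup_of_mem m fun i t ht => ranPre_mem F G hf ht
  | zero => rw [ranMapLin_zero]; exact Submodule.zero_mem _
  | add f f' h1 h2 => rw [ranMapLin_add]; exact Submodule.add_mem _ h1 h2

/-- The right Kan extension of `G` along `F`. -/
def ran : DgMod.{u, u} K C where
  obj X := ranObj F G X
  map f := ⟨ranMapLin F G f, ranMapLin_mem F G f⟩
  map_id X := DGModule.hom_ext <| LinearMap.ext fun t => ran_ext F G fun Y g => by
    simp [ranFamily_ranMapLin]
  map_comp f f' := DGModule.hom_ext <| LinearMap.ext fun t => ran_ext F G fun Y g => by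
    simp [ranFamily_ranMapLin]
  map_add f f' := DGModule.hom_ext (ranMapLin_add F G f f')
  map_smul c f := DGModule.hom_ext <| LinearMap.ext fun t => ran_ext F G fun Y g => by
    simp [ranFamily_ranMapLin, DGModule.smul_lin]
  map_mem hf := fun i t ht => ranPre_mem F G hf ht
  map_d {X X'} f := by
    -- The action is packaged as a linear map in order to reduce to homogeneous `f`, for which the
    -- differential of a map of dg-modules has its explicit form.
    let T : (X ⟶ X') →ₗ[K] (ranObj F G X ⟶ ranObj F G X') :=
      { toFun := fun f => ⟨ranMapLin F G f, ranMapLin_mem F G f⟩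
        map_add' := fun f f' => DGModule.hom_ext (ranMapLin_add F G f f')
        map_smul' := fun c f => DGModule.hom_ext <| LinearMap.ext fun t =>
          ran_ext F G fun Y g => by simp [ranFamily_ranMapLin, DGModule.smul_lin] }
    refine LinearMap.congr_fun ((DGCategory.dg (K := K) X X').linearMap_ext
      (f := T ∘ₗ (DGCategory.dg (K := K) X X').d)
      (g := (DGCategory.dg (K := K) (ranObj F G X) (ranObj F G X')).d ∘ₗ T)
      fun m f hf => DGModule.hom_ext <| LinearMap.ext fun t => ran_ext F G fun Y g => ?_) f
    have hT : T f ∈ homDeg K (ranObj F G X) (ranObj F G X') m :=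
      fun i t ht => ranPre_mem F G hf ht
    have e := DGModule.d_lin hT t
    have e' := congrArg (fun s => ranFamily F G X' s Y g) e
    simp only [ranFamily_d, ranDiff_apply, map_add, map_zsmul_unit] at e'
    change ranFamily F G X t Y (homD K f ≫ g) = _
    change (G.obj Y).dg.d (ranFamily F G X t Y (f ≫ homSign K g)) -
      ranFamily F G X t Y (f ≫ homD K (homSign K g)) =
        ranFamily F G X' ((homD K (T f)).lin t) Y g +
          m.negOnePow • ranDiff F G X (ranFamily F G X t) Y (f ≫ g) at e'
    have hs : homSign K (f ≫ g) = m.negOnePow • (f ≫ homSign K g) := by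
      rw [homSign_comp, homSign, DGStructure.sign_of_mem _ hf]
      simp only [Units.smul_def, Preadditive.zsmul_comp]
    have hs' : homSign K (homSign K g) = g := DGStructure.sign_sign _ g
    have hs'' : homD K (m.negOnePow • (f ≫ homSign K g)) =
        m.negOnePow • homD K (f ≫ homSign K g) := map_zsmul_unit _ _ _
    rw [ranDiff_apply, hs, hs'', map_zsmul_unit, map_zsmul_unit, map_zsmul_unit, ← smul_sub,
      smul_smul, Int.units_mul_self, one_smul, homD_comp, hs', map_add,
      ← sub_eq_zero] at e'
    change _ = ranFamily F G X' ((homD K (T f)).lin t) Y g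
    rw [← sub_eq_zero, ← e']
    abel

/-- The component at `Y` of the counit: evaluation at the identity of `F Y`. -/
def ranCounitApp (Y : A) : (ran F G).obj (F.obj Y) ⟶ G.obj Y :=
  DGModule.homOfDeg (M := ranObj F G (F.obj Y)) (n := 0)
    (LinearMap.applyₗ (𝟙 (F.obj Y)) ∘ₗ LinearMap.proj Y ∘ₗ ranFamily F G (F.obj Y))
    fun i t ht => by
      have := ht.1 Y 0 (𝟙 _) (DGCategory.id_mem _)
      rwa [add_comm] at this

/-- Evaluation at the identity commutes with `d` because `d 𝟙 = 0` and `𝟙` is fixed by the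
involution; it is natural because the families commute with `A`. -/
lemma exists_ranCounit : ∃ ψ : (restrict F).obj (ran F G) ⟶ G, IsClosedZero K ψ ∧
    ψ.app = ranCounitApp F G := by
  refine DGFunctor.exists_isClosedZero (F := (restrict F).obj (ran F G)) _ (fun Y => ?_)
    fun {Y Y'} a => ?_
  · refine DGModule.isClosedZero_homOfDeg (M := ranObj F G (F.obj Y)) _ _ fun t => ?_
    change (G.obj Y).dg.d (ranFamily F G _ t Y (𝟙 _)) = ranFamily F G _ ((ranObj F G (F.obj Y)).dg.d t) Y (𝟙 _)
    rw [ranFamily_d, ranDiff_apply, homSign_id, homD_id, map_zero, sub_zero]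
  · refine DGModule.hom_ext (LinearMap.ext fun t => ?_)
    change (G.map a).lin (ranFamily F G (F.obj Y) t Y (𝟙 _)) =
      ranFamily F G (F.obj Y) t Y' (F.map a ≫ 𝟙 _)
    refine (ranFamily_naturality F G (X := F.obj Y) t a (𝟙 _)).trans ?_
    rw [Category.id_comp, Category.comp_id]

/-- Composing with `T(f)` and the counit evaluates a family at `f`. An element of the right Kan
extension is thus its collection of images under these maps, which gives uniqueness in the universal
property. -/
lemma ran_map_counit_lin {B : DGModule.{u, u} K} {X : C} (β : B ⟶ (ran F G).obj X) {Y : A}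
    (f : X ⟶ F.obj Y) (x : B.carrier) :
    (β ≫ (ran F G).map f ≫ ranCounitApp F G Y).lin x = ranFamily F G X (β.lin x) Y f := by
  change ranFamily F G X (β.lin x) Y (f ≫ 𝟙 _) = _
  rw [Category.comp_id]

/-- The universal property is currying: the map classified by `τ` sends `x` to the family `f ↦
(-1)^{n|f|} τ(f)(x)`. -/
lemma exists_isRightKanExtension :
    ∃ ψ : (restrict F).obj (ran F G) ⟶ G, IsRightKanExtension F G (ran F G) ψ := by
  obtain ⟨ψ, hψ, hψ'⟩ := exists_ranCounit F G
  refine ⟨ψ, hψ, fun X B n τ h1 h2 => ?_⟩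
  rw [hψ']
  -- The twist cancels the sign in the definition of a right Kan extension and makes the family
  -- commute with `A` strictly, as `ranGr` requires.
  let b : B.carrier →ₗ[K] RanFamily F G X := LinearMap.pi fun Y =>
    (DGModule.linLinear B (G.obj Y) ∘ₗ τ Y ∘ₗ
      (DGCategory.dg (K := K) X (F.obj Y)).signPow n).flip
  have hb : ∀ {Y : A} {p : ℤ} {f : X ⟶ F.obj Y}, f ∈ homDeg K X (F.obj Y) p → ∀ x,
      b x Y f = (n * p).negOnePow • (τ Y f).lin x := fun {Y p f} hf x => by
    change (τ Y (DGStructure.signPow _ n f)).lin x = _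
    rw [DGStructure.signPow_of_mem _ n hf, map_zsmul_unit, DGModule.units_smul_lin]
    rfl
  have hbm : ∀ i, ∀ x ∈ B.dg.gr i, b x ∈ ranGr F G X (i + n) := fun i x hx => by
    refine ⟨fun Y p f hf => ?_, fun Y Y' a f => ?_⟩
    · rw [hb hf]
      have := h1 Y p f hf i x hx
      rw [show i + (p + n) = p + (i + n) by ring] at this
      exact DGStructure.units_smul_mem _ _ this
    · induction f using (DGCategory.dg (K := K) X (F.obj Y)).hom_induction with
      | mem p f hf =>
        induction a using (DGCategory.dg (K := K) Y Y').hom_induction with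
        | mem m a ha =>
          have e := congrArg (fun g => DGModule.Hom.lin g x) (h2 m Y Y' a f ha)
          rw [DGModule.units_smul_lin, DGModule.comp_lin, LinearMap.comp_apply,
            LinearMap.smul_apply] at e
          rw [hb hf, hb (DGCategory.comp_mem hf (F.map_mem ha)), map_zsmul_unit, e, smul_smul,
            mul_add, Int.negOnePow_add]
        | zero => rw [G.map_zero, F.map_zero]; simp [DGModule.zero_lin]
        | add a a' h1 h2 => simp [G.map_add, F.map_add, DGModule.add_lin, h1, h2]
      | zero => simp
      | add f f' h1 h2 => simp [h1, h2]
  let β : B ⟶ (ran F G).obj X := DGModule.homOfDeg (N := ranObj F G X) (n := n)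
    (ranLift F G b fun i x hx => Submodule.mem_iSup_of_mem _ (hbm i x hx)) hbm
  refine ⟨β, ⟨hbm, fun Y p f hf => DGModule.hom_ext (LinearMap.ext fun x => ?_)⟩, ?_⟩
  · rw [DGModule.units_smul_lin, LinearMap.smul_apply, ran_map_counit_lin]
    change _ = _ • b x Y f
    rw [hb hf, smul_smul, Int.units_mul_self, one_smul]
  · rintro β' ⟨-, hβ'⟩
    refine DGModule.hom_ext (LinearMap.ext fun x => ran_ext F G fun Y f => ?_)
    induction f using (DGCategory.dg (K := K) X (F.obj Y)).hom_induction with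
    | mem p f hf =>
      change _ = b x Y f
      rw [hb hf, hβ' Y p f hf, DGModule.units_smul_lin, LinearMap.smul_apply, smul_smul,
        Int.units_mul_self, one_smul, ran_map_counit_lin]
    | zero => simp
    | add f f' h1 h2 => rw [map_add, map_add, h1, h2]

end Ran

/-! ### Construction of left Kan extensions -/

/-- With `(-1)^{|f|} f` written as the involution, the rule for `d (f x)` holds for inhomogeneous
`f`, as needed for relations indexed by arbitrary morphisms. -/
lemma DGModule.d_lin_apply {K : Type w} [CommRing K] {M N : DGModule.{w, v} K} (f : M ⟶ N)
    (x : M.carrier) :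
    N.dg.d (f.lin x) = (homD K f).lin x + (homSign K f).lin (M.dg.d x) := by
  induction f using (DGCategory.dg (K := K) M N).hom_induction with
  | mem m f hf =>
    rw [DGModule.d_lin hf, homSign, DGStructure.sign_of_mem _ hf, DGModule.units_smul_lin]
    rfl
  | zero => simp [DGModule.zero_lin]
  | add f g h1 h2 =>
    simp only [homD, homSign] at h1 h2
    simp only [homD, homSign, map_add, DGModule.add_lin, LinearMap.add_apply, h1, h2]
    abel

section Lan

open scoped TensorProduct

variable {K : Type u} [CommRing K]
  {A : Type u} [Category.{u} A] [Preadditive A] [Linear K A] [DGCategory K A]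
  {C : Type u₂} [Category.{u} C] [Preadditive C] [Linear K C] [DGCategory K C]
  (F : DGFunctor K A C) (G : DgMod.{u, u} K A)

open scoped Classical in
/-- The relations between the tensors `f ⊗ x` with `f : F Y ⟶ X` and `x ∈ G Y`. -/
def lanRel (X : C) :
    Submodule K (DirectSum A fun Y => (F.obj Y ⟶ X) ⊗[K] (G.obj Y).carrier) :=
  Submodule.span K {z | ∃ (Y Y' : A) (a : Y ⟶ Y') (f : F.obj Y' ⟶ X) (x : (G.obj Y).carrier),
    z = DirectSum.lof K A (fun Y => (F.obj Y ⟶ X) ⊗[K] (G.obj Y).carrier) Y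
          ((F.map a ≫ f) ⊗ₜ x) -
        DirectSum.lof K A (fun Y => (F.obj Y ⟶ X) ⊗[K] (G.obj Y).carrier) Y'
          (f ⊗ₜ (G.map a).lin x)}

/-- The tensor product of the right module `C(F -, X)` with the left module `G`. -/
abbrev LanModule (X : C) : Type u :=
  (DirectSum A fun Y => (F.obj Y ⟶ X) ⊗[K] (G.obj Y).carrier) ⧸ lanRel F G X

open scoped Classical in
/-- The class of the tensor `f ⊗ x`. -/
def lanTensor (X : C) (Y : A) :
    (F.obj Y ⟶ X) →ₗ[K] (G.obj Y).carrier →ₗ[K] LanModule F G X :=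
  (TensorProduct.mk K (F.obj Y ⟶ X) (G.obj Y).carrier).compr₂
    ((lanRel F G X).mkQ ∘ₗ
      DirectSum.lof K A (fun Y => (F.obj Y ⟶ X) ⊗[K] (G.obj Y).carrier) Y)

variable {F G}

lemma lanTensor_map_comp {X : C} {Y Y' : A} (a : Y ⟶ Y') (f : F.obj Y' ⟶ X)
    (x : (G.obj Y).carrier) :
    lanTensor F G X Y (F.map a ≫ f) x = lanTensor F G X Y' f ((G.map a).lin x) :=
  (Submodule.Quotient.eq _).2 (Submodule.subset_span ⟨Y, Y', a, f, x, rfl⟩)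

section Lift

variable {X : C} {Z : Type v} [AddCommGroup Z] [Module K Z]

lemma lan_linearMap_ext {g g' : LanModule F G X →ₗ[K] Z}
    (h : ∀ (Y : A) (f : F.obj Y ⟶ X) (x : (G.obj Y).carrier),
      g (lanTensor F G X Y f x) = g' (lanTensor F G X Y f x)) : g = g' := by
  classical
  refine Submodule.linearMap_qext _ (DirectSum.linearMap_ext K fun Y => ?_)
  exact TensorProduct.ext (LinearMap.ext fun f => LinearMap.ext fun x => h Y f x)

open scoped Classical in
/-- The universal property of the tensor product. -/
def lanLift (b : ∀ Y : A, (F.obj Y ⟶ X) →ₗ[K] (G.obj Y).carrier →ₗ[K] Z)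
    (hb : ∀ (Y Y' : A) (a : Y ⟶ Y') (f : F.obj Y' ⟶ X) (x : (G.obj Y).carrier),
      b Y (F.map a ≫ f) x = b Y' f ((G.map a).lin x)) : LanModule F G X →ₗ[K] Z :=
  (lanRel F G X).liftQ (DirectSum.toModule K A Z fun Y => TensorProduct.lift (b Y)) <| by
    refine Submodule.span_le.2 ?_
    rintro _ ⟨Y, Y', a, f, x, rfl⟩
    simp [hb]

lemma lanLift_lanTensor (b : ∀ Y : A, (F.obj Y ⟶ X) →ₗ[K] (G.obj Y).carrier →ₗ[K] Z)
    (hb : ∀ (Y Y' : A) (a : Y ⟶ Y') (f : F.obj Y' ⟶ X) (x : (G.obj Y).carrier),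
      b Y (F.map a ≫ f) x = b Y' f ((G.map a).lin x))
    (Y : A) (f : F.obj Y ⟶ X) (x : (G.obj Y).carrier) :
    lanLift b hb (lanTensor F G X Y f x) = b Y f x := by
  classical
  change DirectSum.toModule K A Z (fun Y => TensorProduct.lift (b Y))
    (DirectSum.lof K A (fun Y => (F.obj Y ⟶ X) ⊗[K] (G.obj Y).carrier) Y (f ⊗ₜ x)) = _
  rw [DirectSum.toModule_lof, TensorProduct.lift.tmul]

end Lift

variable (F G)

/-- The component of degree `n` of the tensor product. -/
def lanGr (X : C) (n : ℤ) : Submodule K (LanModule F G X) :=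
  Submodule.span K {z | ∃ (Y : A) (p q : ℤ) (f : F.obj Y ⟶ X) (x : (G.obj Y).carrier),
    f ∈ homDeg K (F.obj Y) X p ∧ x ∈ (G.obj Y).dg.gr q ∧ p + q = n ∧ z = lanTensor F G X Y f x}

variable {F G} in
lemma lanTensor_mem {X : C} {Y : A} {p q n : ℤ} {f : F.obj Y ⟶ X} {x : (G.obj Y).carrier}
    (hf : f ∈ homDeg K (F.obj Y) X p) (hx : x ∈ (G.obj Y).dg.gr q) (h : p + q = n) :
    lanTensor F G X Y f x ∈ lanGr F G X n :=
  Submodule.subset_span ⟨Y, p, q, f, x, hf, hx, h, rfl⟩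

variable {F G} in
lemma lanGr_le {X : C} {n : ℤ} {p : Submodule K (LanModule F G X)}
    (h : ∀ (Y : A) (i j : ℤ) (f : F.obj Y ⟶ X) (x : (G.obj Y).carrier),
      f ∈ homDeg K (F.obj Y) X i → x ∈ (G.obj Y).dg.gr j → i + j = n →
      lanTensor F G X Y f x ∈ p) : lanGr F G X n ≤ p := by
  refine Submodule.span_le.2 ?_
  rintro _ ⟨Y, i, j, f, x, hf, hx, hij, rfl⟩
  exact h Y i j f x hf hx hij

/-- The operation `(f, x) ↦ f ⊗ x`, placed in degree `|f| + |x|`. -/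
def lanCoactionAux (X : C) (Y : A) :
    (F.obj Y ⟶ X) →ₗ[K] (G.obj Y).carrier →ₗ[K] (ℤ →₀ LanModule F G X) :=
  (DGCategory.dg (K := K) (F.obj Y) X).lift fun p =>
    { toFun := fun f => (G.obj Y).dg.lift fun q =>
        Finsupp.lsingle (p + q) ∘ₗ lanTensor F G X Y f ∘ₗ Submodule.subtype _
      map_add' := fun f f' => (G.obj Y).dg.linearMap_ext fun q x hx => by
        simp [DGStructure.lift_of_mem _ _ hx]
      map_smul' := fun c f => (G.obj Y).dg.linearMap_ext fun q x hx => by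
        simp [DGStructure.lift_of_mem _ _ hx] }

lemma lanCoactionAux_of_mem {X : C} {Y : A} {p q : ℤ} {f : F.obj Y ⟶ X} {x : (G.obj Y).carrier}
    (hf : f ∈ homDeg K (F.obj Y) X p) (hx : x ∈ (G.obj Y).dg.gr q) :
    lanCoactionAux F G X Y f x = Finsupp.single (p + q) (lanTensor F G X Y f x) := by
  rw [lanCoactionAux, DGStructure.lift_of_mem _ _ hf]
  simp [DGStructure.lift_of_mem _ _ hx]

/-- The coaction of the grading: `z ↦ z` placed in degree `|z|`. -/
def lanCoaction (X : C) : LanModule F G X →ₗ[K] (ℤ →₀ LanModule F G X) :=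
  lanLift (lanCoactionAux F G X) fun Y Y' a f x => by
    induction a using (DGCategory.dg (K := K) Y Y').hom_induction with
    | mem m a ha =>
      induction f using (DGCategory.dg (K := K) (F.obj Y') X).hom_induction with
      | mem p f hf =>
        induction x using (G.obj Y).dg.hom_induction with
        | mem q x hx =>
          rw [lanCoactionAux_of_mem F G (DGCategory.comp_mem (F.map_mem ha) hf) hx,
            lanCoactionAux_of_mem F G hf ((DGModule.mem_homDeg_iff _).1 (G.map_mem ha) q x hx),
            lanTensor_map_comp,
            show m + p + q = p + (q + m) by ring]
        | zero => simp
        | add x x' h1 h2 => simp [h1, h2]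
      | zero => simp
      | add f f' h1 h2 => simp [h1, h2]
    | zero => rw [F.map_zero, G.map_zero]; simp [DGModule.zero_lin]
    | add a a' h1 h2 => simp [F.map_add, G.map_add, DGModule.add_lin, h1, h2]

/-- The components are spans in a quotient, so their independence is not visible directly. The
coaction is well defined because both tensors in a homogeneous relation have the same total degree,
and it separates the components by recording that degree. -/
lemma lanCoaction_of_mem {X : C} {n : ℤ} {z : LanModule F G X} (hz : z ∈ lanGr F G X n) :
    lanCoaction F G X z = Finsupp.single n z := by
  refine lanGr_le (p := LinearMap.eqLocus (lanCoaction F G X) (Finsupp.lsingle n)) ?_ hz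
  intro Y p q f x hf hx h
  change lanCoaction F G X _ = Finsupp.single n _
  rw [lanCoaction, lanLift_lanTensor, lanCoactionAux_of_mem F G hf hx, h]

lemma iSupIndep_lanGr (X : C) : iSupIndep (lanGr F G X) := by
  refine (iSupIndep_iff_finsetSum_eq_zero_imp_eq_zero _).2 fun s z hz h n hn => ?_
  have h0 := congrArg (fun y => lanCoaction F G X y n) h
  simp only [map_sum, map_zero, Finsupp.finsetSum_apply, Finsupp.coe_zero, Pi.zero_apply] at h0
  rw [Finset.sum_eq_single_of_mem n hn, lanCoaction_of_mem F G (hz n hn),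
    Finsupp.single_eq_same] at h0
  · exact h0
  · intro m hm hne
    rw [lanCoaction_of_mem F G (hz m hm), Finsupp.single_eq_of_ne hne.symm]

lemma lanTensor_mem_iSup (X : C) (Y : A) (f : F.obj Y ⟶ X) (x : (G.obj Y).carrier) :
    lanTensor F G X Y f x ∈ ⨆ n, lanGr F G X n :=
  biadd_mem_iSup (p := homDeg K (F.obj Y) X) (q := (G.obj Y).dg.gr) (r := lanGr F G X)
    (fun f x => lanTensor F G X Y f x) (by simp) (by simp)
    (fun _ _ _ hf _ hx => lanTensor_mem hf hx rfl)
    (DGStructure.mem_iSup_gr _ f) (DGStructure.mem_iSup_gr _ x)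

/-- The projection modulo the sum of the components kills all pure tensors, hence vanishes. -/
lemma iSup_lanGr (X : C) : ⨆ n, lanGr F G X n = ⊤ := by
  have h : (⨆ n, lanGr F G X n).mkQ = 0 := lan_linearMap_ext fun Y f x => by
    simpa using lanTensor_mem_iSup F G X Y f x
  rw [← Submodule.ker_mkQ (⨆ n, lanGr F G X n), h, LinearMap.ker_zero]

/-- The differential `d (f ⊗ x) = d f ⊗ x + (-1)^{|f|} f ⊗ d x`. -/
def lanDiff (X : C) : LanModule F G X →ₗ[K] LanModule F G X :=
  lanLift (fun Y => lanTensor F G X Y ∘ₗ (DGCategory.dg (K := K) (F.obj Y) X).d +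
      (lanTensor F G X Y ∘ₗ (DGCategory.dg (K := K) (F.obj Y) X).sign).compl₂ (G.obj Y).dg.d)
    fun Y Y' a f x => by
      -- Compatibility with the relations: both sides expand to `d f ⊗ a x`, `sign f ⊗ (d a) x` and
      -- `sign f ⊗ (sign a)(d x)`, by the Leibniz rules in `C` and in `G`.
      change lanTensor F G X Y (homD K (F.map a ≫ f)) x +
          lanTensor F G X Y (homSign K (F.map a ≫ f)) ((G.obj Y).dg.d x) =
        lanTensor F G X Y' (homD K f) ((G.map a).lin x) +
          lanTensor F G X Y' (homSign K f) ((G.obj Y').dg.d ((G.map a).lin x))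
      rw [DGModule.d_lin_apply, homD_comp, homSign_comp, ← F.map_d, ← F.map_homSign, map_add,
        LinearMap.add_apply, lanTensor_map_comp, lanTensor_map_comp, lanTensor_map_comp,
        G.map_d, G.map_homSign, map_add, add_assoc]

lemma lanDiff_lanTensor {X : C} {Y : A} (f : F.obj Y ⟶ X) (x : (G.obj Y).carrier) :
    lanDiff F G X (lanTensor F G X Y f x) = lanTensor F G X Y (homD K f) x +
      lanTensor F G X Y (homSign K f) ((G.obj Y).dg.d x) := by
  rw [lanDiff, lanLift_lanTensor]
  rfl

/-- The value at `X` of the left Kan extension of `G` along `F`. -/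
def lanObj (X : C) : DGModule.{u, u} K where
  carrier := LanModule F G X
  dg :=
    { gr := lanGr F G X
      isInternal := DirectSum.isInternal_submodule_of_iSupIndep_of_iSup_eq_top
        (iSupIndep_lanGr F G X) (iSup_lanGr F G X)
      d := lanDiff F G X
      d_mem := fun {n z} hz => by
        refine lanGr_le (p := (lanGr F G X (n + 1)).comap (lanDiff F G X)) ?_ hz
        intro Y p q f x hf hx h
        rw [Submodule.mem_comap, lanDiff_lanTensor]
        exact Submodule.add_mem _
          (lanTensor_mem (DGStructure.d_mem _ hf) hx (by omega))
          (lanTensor_mem (DGStructure.sign_mem _ hf) (DGStructure.d_mem _ hx) (by omega))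
      d_d := fun z => by
        refine LinearMap.congr_fun (lan_linearMap_ext (g := lanDiff F G X ∘ₗ lanDiff F G X)
          (g' := 0) fun Y f x => ?_) z
        -- The involution anticommutes with `d`, so the two mixed terms `d f ⊗ d x` cancel.
        have hs : homSign K (homD K f) = - homD K (homSign K f) := DGStructure.sign_d _ f
        have hd : homD K (homD K f) = 0 := DGStructure.d_d _ f
        rw [LinearMap.comp_apply, lanDiff_lanTensor, map_add, lanDiff_lanTensor,
          lanDiff_lanTensor, hs, hd, DGStructure.d_d]
        simp }

/-- The class of the tensor `f ⊗ x`, as an element of the left Kan extension. -/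
def lanPure (X : C) (Y : A) :
    (F.obj Y ⟶ X) →ₗ[K] (G.obj Y).carrier →ₗ[K] (lanObj F G X).carrier :=
  lanTensor F G X Y

lemma lanPure_map_comp {X : C} {Y Y' : A} (a : Y ⟶ Y') (f : F.obj Y' ⟶ X)
    (x : (G.obj Y).carrier) :
    lanPure F G X Y (F.map a ≫ f) x = lanPure F G X Y' f ((G.map a).lin x) :=
  lanTensor_map_comp a f x

variable {F G} in
lemma lanPure_mem {X : C} {Y : A} {p q n : ℤ} {f : F.obj Y ⟶ X} {x : (G.obj Y).carrier}
    (hf : f ∈ homDeg K (F.obj Y) X p) (hx : x ∈ (G.obj Y).dg.gr q) (h : p + q = n) :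
    lanPure F G X Y f x ∈ (lanObj F G X).dg.gr n :=
  lanTensor_mem hf hx h

variable {F G} in
lemma lanObj_gr_le {X : C} {n : ℤ} {p : Submodule K (lanObj F G X).carrier}
    (h : ∀ (Y : A) (i j : ℤ) (f : F.obj Y ⟶ X) (x : (G.obj Y).carrier),
      f ∈ homDeg K (F.obj Y) X i → x ∈ (G.obj Y).dg.gr j → i + j = n →
      lanPure F G X Y f x ∈ p) : (lanObj F G X).dg.gr n ≤ p :=
  lanGr_le h

variable {F G} in
lemma lanObj_linearMap_ext {X : C} {Z : Type v} [AddCommGroup Z] [Module K Z]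
    {g g' : (lanObj F G X).carrier →ₗ[K] Z}
    (h : ∀ (Y : A) (f : F.obj Y ⟶ X) (x : (G.obj Y).carrier),
      g (lanPure F G X Y f x) = g' (lanPure F G X Y f x)) : g = g' :=
  lan_linearMap_ext h

/-- The universal property of the left Kan extension at an object. -/
def lanDesc {X : C} {Z : Type v} [AddCommGroup Z] [Module K Z]
    (b : ∀ Y : A, (F.obj Y ⟶ X) →ₗ[K] (G.obj Y).carrier →ₗ[K] Z)
    (hb : ∀ (Y Y' : A) (a : Y ⟶ Y') (f : F.obj Y' ⟶ X) (x : (G.obj Y).carrier),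
      b Y (F.map a ≫ f) x = b Y' f ((G.map a).lin x)) : (lanObj F G X).carrier →ₗ[K] Z :=
  lanLift b hb

lemma lanDesc_lanPure {X : C} {Z : Type v} [AddCommGroup Z] [Module K Z]
    (b : ∀ Y : A, (F.obj Y ⟶ X) →ₗ[K] (G.obj Y).carrier →ₗ[K] Z)
    (hb : ∀ (Y Y' : A) (a : Y ⟶ Y') (f : F.obj Y' ⟶ X) (x : (G.obj Y).carrier),
      b Y (F.map a ≫ f) x = b Y' f ((G.map a).lin x))
    (Y : A) (f : F.obj Y ⟶ X) (x : (G.obj Y).carrier) :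
    lanDesc F G b hb (lanPure F G X Y f x) = b Y f x :=
  lanLift_lanTensor b hb Y f x

variable {F G} in
lemma lanHom_ext {X : C} {N : DGModule.{u, u} K} {g g' : lanObj F G X ⟶ N}
    (h : ∀ (Y : A) (f : F.obj Y ⟶ X) (x : (G.obj Y).carrier),
      g.lin (lanPure F G X Y f x) = g'.lin (lanPure F G X Y f x)) : g = g' :=
  DGModule.hom_ext (lanObj_linearMap_ext h)

/-- The action of a morphism on the left Kan extension, as a linear map. -/
def lanMapLin {X X' : C} (h : X ⟶ X') : (lanObj F G X).carrier →ₗ[K] (lanObj F G X').carrier :=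
  lanDesc F G (fun Y => lanPure F G X' Y ∘ₗ Linear.rightComp K (F.obj Y) h) fun Y Y' a f x => by
    simp [lanPure_map_comp]

lemma lanMapLin_lanPure {X X' : C} (h : X ⟶ X') {Y : A} (f : F.obj Y ⟶ X)
    (x : (G.obj Y).carrier) :
    lanMapLin F G h (lanPure F G X Y f x) = lanPure F G X' Y (f ≫ h) x :=
  lanDesc_lanPure _ _ _ _ _ _ _

/-- The action of morphisms on the left Kan extension, as a linear operation. -/
def lanMapLinear (X X' : C) :
    (X ⟶ X') →ₗ[K] (lanObj F G X).carrier →ₗ[K] (lanObj F G X').carrier where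
  toFun := lanMapLin F G
  map_add' h h' := lanObj_linearMap_ext fun Y f x => by
    rw [LinearMap.add_apply, lanMapLin_lanPure, lanMapLin_lanPure, lanMapLin_lanPure]
    simp
  map_smul' c h := lanObj_linearMap_ext fun Y f x => by
    rw [RingHom.id_apply, LinearMap.smul_apply, lanMapLin_lanPure, lanMapLin_lanPure]
    simp

lemma lanMapLin_mem_homGr {X X' : C} {m : ℤ} {h : X ⟶ X'} (hh : h ∈ homDeg K X X' m) :
    lanMapLin F G h ∈ DGModule.homGr (lanObj F G X) (lanObj F G X') m := by
  intro n z hz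
  refine lanObj_gr_le (p := ((lanObj F G X').dg.gr (n + m)).comap (lanMapLin F G h)) ?_ hz
  intro Y p q f x hf hx hpq
  rw [Submodule.mem_comap, lanMapLin_lanPure]
  exact lanPure_mem (DGCategory.comp_mem hf hh) hx (by omega)

/-- The action of morphisms on the left Kan extension. -/
def lanMap (X X' : C) : (X ⟶ X') →ₗ[K] (lanObj F G X ⟶ lanObj F G X') where
  toFun h := ⟨lanMapLin F G h, by
    change lanMapLinear F G X X' h ∈ DGModule.homTotal (lanObj F G X) (lanObj F G X')
    induction h using (DGCategory.dg (K := K) X X').hom_induction with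
    | mem m h hh => exact Submodule.mem_iSup_of_mem m (lanMapLin_mem_homGr F G hh)
    | zero => rw [map_zero]; exact Submodule.zero_mem _
    | add h h' h1 h2 => rw [map_add]; exact Submodule.add_mem _ h1 h2⟩
  map_add' h h' := DGModule.hom_ext ((lanMapLinear F G X X').map_add h h')
  map_smul' c h := DGModule.hom_ext ((lanMapLinear F G X X').map_smul c h)

lemma lanMap_lanPure {X X' : C} (h : X ⟶ X') {Y : A} (f : F.obj Y ⟶ X)
    (x : (G.obj Y).carrier) :
    (lanMap F G X X' h).lin (lanPure F G X Y f x) = lanPure F G X' Y (f ≫ h) x :=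
  lanMapLin_lanPure F G h f x

lemma lanObj_d_lanPure {X : C} {Y : A} (f : F.obj Y ⟶ X) (x : (G.obj Y).carrier) :
    (lanObj F G X).dg.d (lanPure F G X Y f x) = lanPure F G X Y (homD K f) x +
      lanPure F G X Y (homSign K f) ((G.obj Y).dg.d x) :=
  lanDiff_lanTensor F G f x

/-- On `f ⊗ x`, the Leibniz rule for `f ≫ h` yields `(f ≫ d h) ⊗ x` together with exactly the terms
that the differential of the map `- ≫ h` subtracts. -/
lemma lanMap_homD {X X' : C} (h : X ⟶ X') :
    lanMap F G X X' (homD K h) = homD K (lanMap F G X X' h) := by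
  refine LinearMap.congr_fun ((DGCategory.dg (K := K) X X').linearMap_ext
    (f := lanMap F G X X' ∘ₗ (DGCategory.dg (K := K) X X').d)
    (g := (DGCategory.dg (K := K) (lanObj F G X) (lanObj F G X')).d ∘ₗ lanMap F G X X')
    fun m h hh => lanHom_ext fun Y f x => ?_) h
  have hT : lanMap F G X X' h ∈ homDeg K (lanObj F G X) (lanObj F G X') m :=
    lanMapLin_mem_homGr F G hh
  have e := DGModule.d_lin hT (lanPure F G X Y f x)
  rw [lanMap_lanPure, lanObj_d_lanPure, lanObj_d_lanPure] at e
  have hs : homSign K h = m.negOnePow • h := DGStructure.sign_of_mem _ hh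
  have e1 : ∀ (g : F.obj Y ⟶ X) (y : (G.obj Y).carrier),
      lanPure F G X' Y (g ≫ (m.negOnePow • h)) y =
        m.negOnePow • lanPure F G X' Y (g ≫ h) y := fun g y => by
    rw [Units.smul_def, Preadditive.comp_zsmul, map_zsmul]
    rfl
  rw [homD_comp, homSign_comp, hs, map_add, LinearMap.add_apply, e1, e1, map_add,
    lanMap_lanPure, lanMap_lanPure, smul_add, ← sub_eq_zero] at e
  change (lanMap F G X X' (homD K h)).lin _ = (homD K (lanMap F G X X' h)).lin _
  rw [lanMap_lanPure, ← sub_eq_zero, ← e]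
  abel

/-- The left Kan extension of `G` along `F`. -/
def lan : DgMod.{u, u} K C where
  obj X := lanObj F G X
  map {X X'} h := lanMap F G X X' h
  map_id X := lanHom_ext fun Y f x => by
    rw [lanMap_lanPure, Category.comp_id]
    rfl
  map_comp h h' := lanHom_ext fun Y f x => by
    change _ = (lanMap F G _ _ h').lin ((lanMap F G _ _ h).lin _)
    rw [lanMap_lanPure, lanMap_lanPure, lanMap_lanPure, Category.assoc]
  map_add h h' := map_add _ h h'
  map_smul c h := map_smul _ c h
  map_mem hh := lanMapLin_mem_homGr F G hh
  map_d h := lanMap_homD F G h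

/-- The component at `Y` of the unit: `x ↦ 𝟙 ⊗ x`. -/
def lanUnitApp (Y : A) : G.obj Y ⟶ (lan F G).obj (F.obj Y) :=
  DGModule.homOfDeg (N := lanObj F G (F.obj Y)) (n := 0) (lanPure F G (F.obj Y) Y (𝟙 _))
    fun i x hx => lanPure_mem (DGCategory.id_mem _) hx (by omega)

/-- Every pure tensor `f ⊗ x` is `S(f)(φ_Y(x))`, so the maps in the pointwise universal property are
determined by, and tested on, pure tensors. -/
lemma lanUnitApp_map_lin {X : C} {Y : A} (f : F.obj Y ⟶ X) (x : (G.obj Y).carrier) :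
    (lanUnitApp F G Y ≫ (lan F G).map f).lin x = lanPure F G X Y f x := by
  change (lanMap F G _ X f).lin (lanPure F G (F.obj Y) Y (𝟙 _) x) = _
  rw [lanMap_lanPure, Category.id_comp]

lemma exists_lanUnit : ∃ φ : G ⟶ (restrict F).obj (lan F G), IsClosedZero K φ ∧
    φ.app = lanUnitApp F G := by
  refine DGFunctor.exists_isClosedZero (G := (restrict F).obj (lan F G)) _ (fun Y => ?_)
    fun {Y Y'} a => ?_
  · refine DGModule.isClosedZero_homOfDeg (N := lanObj F G (F.obj Y)) _ _ fun x => ?_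
    rw [lanObj_d_lanPure, homD_id, homSign_id, map_zero, LinearMap.zero_apply, zero_add]
  · refine DGModule.hom_ext (LinearMap.ext fun x => ?_)
    refine (lanUnitApp_map_lin F G (F.map a) x).trans ?_
    -- The defining relation with `f = 𝟙` gives `F a ⊗ x = 𝟙 ⊗ a x`, which is naturality of the
    -- unit.
    conv_lhs => rw [← Category.comp_id (F.map a), lanPure_map_comp]
    rfl

/-- The family `τ` is a bilinear map `(f, x) ↦ τ(f)(x)` that respects the relations, so it factors
uniquely through the tensor product; no signs enter. -/
lemma exists_isLeftKanExtension :
    ∃ φ : G ⟶ (restrict F).obj (lan F G), IsLeftKanExtension F G (lan F G) φ := by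
  obtain ⟨φ, hφ, hφ'⟩ := exists_lanUnit F G
  refine ⟨φ, hφ, fun X B n τ h1 h2 => ?_⟩
  rw [hφ']
  let b : (lanObj F G X).carrier →ₗ[K] B.carrier :=
    lanDesc F G (fun Y => DGModule.linLinear (G.obj Y) B ∘ₗ τ Y) fun Y Y' a f x => by
      change (τ Y (F.map a ≫ f)).lin x = (τ Y' f).lin ((G.map a).lin x)
      rw [h2]
      rfl
  have hb : ∀ (Y : A) (f : F.obj Y ⟶ X) x, b (lanPure F G X Y f x) = (τ Y f).lin x :=
    fun Y f x => lanDesc_lanPure _ _ _ _ Y f x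
  have hbm : ∀ i, ∀ z ∈ (lanObj F G X).dg.gr i, b z ∈ B.dg.gr (i + n) := fun i z hz => by
    refine lanObj_gr_le (p := (B.dg.gr (i + n)).comap b) ?_ hz
    intro Y p q f x hf hx h
    rw [Submodule.mem_comap, hb]
    have := h1 Y p f hf q x hx
    rwa [show q + (p + n) = i + n by omega] at this
  refine ⟨DGModule.homOfDeg (M := lanObj F G X) b hbm, ⟨hbm, fun Y f => ?_⟩, ?_⟩
  · refine DGModule.hom_ext (LinearMap.ext fun x => ?_)
    rw [← hb, ← lanUnitApp_map_lin]
    rfl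
  · rintro β' ⟨-, hβ'⟩
    refine (lanHom_ext fun Y f x => ?_)
    change β'.lin (lanPure F G X Y f x) = b (lanPure F G X Y f x)
    rw [hb, hβ', ← lanUnitApp_map_lin]
    rfl

end Lan

/-! ### Kan extension functors -/

section KanFunctors

variable {K : Type u} [CommRing K]
  {A : Type u} [Category.{u} A] [Preadditive A] [Linear K A] [DGCategory K A]
  {C : Type u₂} [Category.{u} C] [Preadditive C] [Linear K C] [DGCategory K C]
  (F : DGFunctor K A C)

lemma exists_isLanFunctor : ∃ L : DGFunctor K (DgMod.{u, u} K A) (DgMod.{u, u} K C),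
    IsLanFunctor F L ∧ IsDGAdjoint L (restrict F) ∧
      (F.IsFullyFaithful → L.IsFullyFaithful) := by
  choose φ hφ using fun G => exists_isLeftKanExtension F G
  have h := fun G => (hφ G).isUniversalFrom
  exact ⟨leftAdjointOfUniversal h,
    ⟨φ, hφ, fun _ _ η => unit_leftAdjointOfUniversal h η⟩,
    isDGAdjoint_leftAdjointOfUniversal h,
    fun hF => isFullyFaithful_leftAdjointOfUniversal h fun G => (hφ G).isIso_unit hF⟩

lemma exists_isRanFunctor : ∃ R : DGFunctor K (DgMod.{u, u} K A) (DgMod.{u, u} K C),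
    IsRanFunctor F R ∧ IsDGAdjoint (restrict F) R ∧
      (F.IsFullyFaithful → R.IsFullyFaithful) := by
  choose ψ hψ using fun G => exists_isRightKanExtension F G
  have h := fun G => (hψ G).isUniversalTo
  exact ⟨rightAdjointOfUniversal h,
    ⟨ψ, hψ, fun _ _ η => counit_rightAdjointOfUniversal h η⟩,
    isDGAdjoint_rightAdjointOfUniversal h,
    fun hF => isFullyFaithful_rightAdjointOfUniversal h fun G => (hψ G).isIso_counit hF⟩

end KanFunctors

lemma isFullyFaithful_inclusion {K : Type w} [CommRing K] {C : Type u} [Category.{v} C]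
    [Preadditive C] [Linear K C] [DGCategory K C] (P : ObjectProperty C) :
    (inclusion (K := K) P).IsFullyFaithful := fun X Y =>
  (fullHomEquiv P K X Y).bijective

/-! ### Dg-modules over a quotient -/

section Quotient

variable {K : Type w} [CommRing K] {C : Type u₁} [Category.{v₁} C] [Preadditive C] [Linear K C]
  [DGCategory K C] (I : DGIdeal K C)

/-- The quotient has the objects of `C`, and each homogeneous class has a representative of the same
degree. A family that is natural over `C` is therefore already natural over the quotient. -/
lemma isFullyFaithful_restrict_proj :
    (restrict.{w, v} (DGQuotient.proj I)).IsFullyFaithful := by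
  refine fun M N => ⟨fun η θ h => DGFunctor.hom_ext fun X => ?_, fun θ => ?_⟩
  · exact congrArg (fun ζ => ζ.app X.as) h
  · have hmem : ∀ θ ∈ DGFunctor.natTotal ((restrict (DGQuotient.proj I)).obj M)
        ((restrict (DGQuotient.proj I)).obj N),
        (fun X : DGQuotient I => (show M.obj X ⟶ N.obj X from θ X.as)) ∈
          DGFunctor.natTotal M N := fun θ hθ => by
      induction hθ using Submodule.iSup_induction' with
      | mem n θ hθ =>
        refine Submodule.mem_iSup_of_mem n ⟨fun X => hθ.1 X.as, ?_⟩
        rintro m X Y _ ⟨f, hf, rfl⟩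
        exact hθ.2 m X.as Y.as f hf
      | zero => exact Submodule.zero_mem _
      | add θ θ' _ _ h1 h2 => exact Submodule.add_mem _ h1 h2
    exact ⟨⟨_, hmem θ.app θ.mem⟩, rfl⟩

variable {D : Type u₂} [Category.{v₂} D] [Preadditive D] [Linear K D] [DGCategory K D]

/-- The dg-functor on the quotient induced by a dg-functor that vanishes on the ideal. -/
def DGQuotient.desc (M : DGFunctor K C D) (hM : ∀ {X Y : C} (f : X ⟶ Y), f ∈ I.sub X Y →
    M.map f = 0) : DGFunctor K (DGQuotient I) D where
  obj X := M.obj X.as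
  map {X Y} := (I.sub X.as Y.as).liftQ (M.mapLinear X.as Y.as) fun f hf => hM f hf
  map_id X := M.map_id X.as
  map_comp {X Y Z} f g := by
    obtain ⟨f, rfl⟩ := (I.sub _ _).mkQ_surjective f
    obtain ⟨g, rfl⟩ := (I.sub _ _).mkQ_surjective g
    exact M.map_comp f g
  map_add f g := map_add ((I.sub _ _).liftQ (M.mapLinear _ _) fun f hf => hM f hf) f g
  map_smul c f := map_smul ((I.sub _ _).liftQ (M.mapLinear _ _) fun f hf => hM f hf) c f
  map_mem := by
    rintro X Y n _ ⟨f, hf, rfl⟩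
    exact M.map_mem hf
  map_d {X Y} f := by
    obtain ⟨f, rfl⟩ := (I.sub _ _).mkQ_surjective f
    exact M.map_d f

/-- `M` factors strictly through the quotient. Its factorisation restricts to a module with the same
values, and the identities form the isomorphism in both directions. -/
lemma closedIm_restrict_proj {M : DgMod.{w, v} K C}
    (hM : ∀ {X Y : C} (f : X ⟶ Y), f ∈ I.sub X Y → M.map f = 0) :
    (restrict (DGQuotient.proj I)).closedIm M := by
  let N : DgMod.{w, v} K C := (restrict (DGQuotient.proj I)).obj (DGQuotient.desc I M hM)
  have hid : ∀ X : C, IsClosedZero K (𝟙 (M.obj X)) := fun X => ⟨DGCategory.id_mem _, homD_id _⟩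
  obtain ⟨θ, hθ, hθ'⟩ := DGFunctor.exists_isClosedZero (F := N) (G := M)
    (fun X => 𝟙 (M.obj X)) hid fun f => (Category.id_comp (M.map f)).trans
      (Category.comp_id (M.map f)).symm
  obtain ⟨θ', hθ₁, hθ₁'⟩ := DGFunctor.exists_isClosedZero (F := M) (G := N)
    (fun X => 𝟙 (M.obj X)) hid fun f => (Category.id_comp (M.map f)).trans
      (Category.comp_id (M.map f)).symm
  refine ⟨DGQuotient.desc I M hM, ⟨θ, θ', ?_, ?_⟩, hθ, hθ₁⟩
  · refine DGFunctor.hom_ext fun X => ?_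
    rw [DGFunctor.comp_app, hθ', hθ₁']
    exact Category.comp_id (𝟙 (M.obj X))
  · refine DGFunctor.hom_ext fun X => ?_
    rw [DGFunctor.comp_app, hθ', hθ₁']
    exact Category.comp_id (𝟙 (M.obj X))

end Quotient

lemma DGFunctor.closedIm_le_im {K : Type w} [CommRing K]
    {C : Type u₁} [Category.{v₁} C] [Preadditive C] [Linear K C] [DGCategory K C]
    {D : Type u₂} [Category.{v₂} D] [Preadditive D] [Linear K D] [DGCategory K D]
    (F : DGFunctor K C D) : F.closedIm ≤ F.im :=
  fun _ ⟨Y, e, _⟩ => ⟨Y, ⟨e⟩⟩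

/-! ### The image of `π_*` and the kernel of `j^*` -/

section Kernel

variable {K : Type w} [CommRing K] {C : Type u₁} [Category.{v₁} C] [Preadditive C] [Linear K C]
  [DGCategory K C]

/-- A dg-functor is a zero object if and only if its values have vanishing identities. -/
lemma DGFunctor.isZero_iff {D : Type u₂} [Category.{v₂} D] [Preadditive D] [Linear K D]
    [DGCategory K D] (F : DGFunctor K C D) : IsZero F ↔ ∀ X, 𝟙 (F.obj X) = 0 := by
  rw [IsZero.iff_id_eq_zero]
  exact ⟨fun h X => congrArg (fun η => DGFunctor.Hom.app η X) h, fun h => DGFunctor.hom_ext h⟩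

lemma ker_restrict_inclusion_iff {P : ObjectProperty C} (M : DgMod.{w, v} K C) :
    (restrict (inclusion (K := K) P)).ker M ↔ ∀ B, P B → 𝟙 (M.obj B) = 0 :=
  (DGFunctor.isZero_iff _).trans
    ⟨fun h B hB => h ⟨B, hB⟩, fun h X => h X.obj X.property⟩

variable [HasFiniteCoproducts C] {P : ObjectProperty C} (hP : ClosedUnderFiniteCoproducts P)

/-- `M(h ∘ g)` factors through `M(B)`, whose identity vanishes; sums of such morphisms are killed by
additivity. -/
lemma map_eq_zero_of_mem_factorIdeal {M : DgMod.{w, v} K C} (hM : ∀ B, P B → 𝟙 (M.obj B) = 0)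
    {X Y : C} (f : X ⟶ Y) (hf : f ∈ (factorIdeal K hP).sub X Y) : M.map f = 0 := by
  change f ∈ ⨆ n, factorGr K hP X Y n at hf
  induction hf using Submodule.iSup_induction' with
  | mem n f hf =>
    obtain ⟨-, B, hB, g, h, rfl⟩ := hf
    rw [M.map_comp, ← Category.id_comp (M.map h), hM B hB, zero_comp, comp_zero]
  | zero => exact M.map_zero X Y
  | add f g _ _ h1 h2 => rw [M.map_add, h1, h2, add_zero]

/-- `1_B` factors through `B`, so its class in the quotient is zero and modules over the quotient
vanish at `B`. The isomorphism only transports the vanishing of an identity, so it need be neither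
closed nor of degree zero. -/
lemma im_restrict_proj_le_ker :
    (restrict.{w, v} (DGQuotient.proj (factorIdeal K hP))).im ≤
      (restrict (inclusion (K := K) P)).ker := by
  rintro M ⟨N, ⟨e⟩⟩
  rw [ker_restrict_inclusion_iff]
  intro B hB
  have h0 : DGQuotient.cls (factorIdeal K hP) (𝟙 B) = 0 :=
    (Submodule.Quotient.mk_eq_zero _).2 <| by
      have := comp_mem_factor (K := K) hP hB (𝟙 B) (𝟙 B)
      rwa [Category.id_comp] at this
  have h1 : 𝟙 (N.obj ⟨B⟩) = 0 := by
    rw [← N.map_id]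
    exact (congrArg (fun f => N.map f) h0).trans (N.map_zero _ _)
  have h2 : 𝟙 (M.obj B) = e.inv.app B ≫ e.hom.app B :=
    (congrArg (fun η => DGFunctor.Hom.app η B) e.inv_hom_id).symm
  have h3 : e.inv.app B = 0 :=
    (Category.comp_id (Y := N.obj ⟨B⟩) (e.inv.app B)).symm.trans (by rw [h1]; exact comp_zero)
  rw [h2, h3, zero_comp]

lemma ker_le_closedIm_restrict_proj :
    (restrict.{w, v} (inclusion (K := K) P)).ker ≤
      (restrict (DGQuotient.proj (factorIdeal K hP))).closedIm := fun M hM =>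
  closedIm_restrict_proj _
    (map_eq_zero_of_mem_factorIdeal hP ((ker_restrict_inclusion_iff M).1 hM))

end Kernel

end DG

end

/-! ### The recollement -/

theorem mainTheorem1 {K : Type u} [CommRing K]
    {C : Type u} [SmallCategory C] [Preadditive C] [Linear K C] [DG.DGCategory K C]
    [HasFiniteCoproducts C] (P : ObjectProperty C) (hP : DG.ClosedUnderFiniteCoproducts P) :
    ∃ (πL πR : DG.DGFunctor K (DG.DgMod.{u, u} K C)
        (DG.DgMod.{u, u} K (DG.DGQuotient (DG.factorIdeal K hP))))
      (jL jR : DG.DGFunctor K (DG.DgMod.{u, u} K P.FullSubcategory) (DG.DgMod.{u, u} K C)),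
      DG.IsLanFunctor (DG.DGQuotient.proj (DG.factorIdeal K hP)) πL ∧
      DG.IsRanFunctor (DG.DGQuotient.proj (DG.factorIdeal K hP)) πR ∧
      DG.IsLanFunctor (DG.inclusion (K := K) P) jL ∧
      DG.IsRanFunctor (DG.inclusion (K := K) P) jR ∧
      DG.IsDGRecollement πL (DG.restrict (DG.DGQuotient.proj (DG.factorIdeal K hP))) πR
        jL (DG.restrict (DG.inclusion (K := K) P)) jR := by
  obtain ⟨πL, hπL, aπL, -⟩ := DG.exists_isLanFunctor (DG.DGQuotient.proj (DG.factorIdeal K hP))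
  obtain ⟨πR, hπR, aπR, -⟩ := DG.exists_isRanFunctor (DG.DGQuotient.proj (DG.factorIdeal K hP))
  obtain ⟨jL, hjL, ajL, fjL⟩ := DG.exists_isLanFunctor (DG.inclusion (K := K) P)
  obtain ⟨jR, hjR, ajR, fjR⟩ := DG.exists_isRanFunctor (DG.inclusion (K := K) P)
  -- The inclusions im ≤ ker ≤ closedIm ≤ im form a cycle, which settles both versions of the
  -- essential image.
  have h1 := DG.im_restrict_proj_le_ker.{u, u} (K := K) hP
  have h2 := DG.ker_le_closedIm_restrict_proj.{u, u} (K := K) hP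
  have h3 := DG.DGFunctor.closedIm_le_im
    (DG.restrict.{u, u} (DG.DGQuotient.proj (DG.factorIdeal K hP)))
  exact ⟨πL, πR, jL, jR, hπL, hπR, hjL, hjR,
    { adj_iL_i := aπL
      adj_i_iR := aπR
      adj_jL_j := ajL
      adj_j_jR := ajR
      im_eq_ker := le_antisymm h1 (h2.trans h3)
      closedIm_eq_ker := le_antisymm (h3.trans h1) h2
      i_fullyFaithful := DG.isFullyFaithful_restrict_proj _
      jL_fullyFaithful := fjL (DG.isFullyFaithful_inclusion P)
      jR_fullyFaithful := fjR (DG.isFullyFaithful_inclusion P) }⟩
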